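/- Let $G$ be a finite simple graph with vertex set $V(G)=\{y_1,\dots,y_m\}$, regarded as a simplicial complex of dimension at most $1$, and let $n\ge 0$. Let $\Delta^{n-1}$ be the full simplex on vertices $x_1,\dots,x_n$, let $K=\Delta^{n-1}\ast G$ be the join, and let $$A(n,G)=\mathbb Z[x_1,\dots,x_n,y_1,\dots,y_m]/I_K,\qquad |x_i|=4,\quad |y_j|=6,$$ be the graded Stanley–Reisner ring of $K$, where $I_K$ is the ideal generated by the square-free monomials $\prod_{v\in s}v$ with $s\notin K$. For a field $\mathbf k$, an $n$-span colouring of $G$ over $\mathbf k$ assigns to each vertex $v$ a line $U_v\subset\mathbf k^n$ and a subspace $W_v\subset\mathbf k^n$ of dimension $n-1$ such that $U_v\not\subset W_v$ for every vertex $v$, and $U_v\subset W_w$ and $U_w\subset W_v$ for every edge $vw$. Let $s_2\chi(G)$ be the least $n$ such that $G$ has an $n$-span colouring over $\mathbb Z/2$. Let $\mathcal A_2$ be the mod-$2$ Steenrod algebra, that is, the $\mathbb Z/2$-algebra generated by $\operatorname{Sq}^i$ ($i\ge 0$) subject to $\operatorname{Sq}^0=1$ and the Adem relations. An (unstable) $\mathcal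 A_2$ action on a commutative graded $\mathbb Z/2$-algebra $A$ is an $\mathcal A_2$-module structure on $A$ such that $\operatorname{Sq}^k$ raises degrees by $k$, the Cartan formula $\operatorname{Sq}^k(ab)=\sum_{i=0}^k\operatorname{Sq}^i(a)\operatorname{Sq}^{k-i}(b)$ holds, and for every $a$ of degree $d$ one has $\operatorname{Sq}^d(a)=a^2$ and $\operatorname{Sq}^k(a)=0$ for $k>d$. **Theorem.** The graded algebra $A(n,G)\otimes\mathbb Z/2$ admits an unstable $\mathcal A_2$ action if and only if $s_2\chi(G)\le n$. -/

import Mathlib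

open scoped TensorProduct DirectSum

/-! ### Span colourings of graphs -/

/-- An `n`-span colouring of a graph `G` over a field `k`: every vertex `v` gets a line
`line v ∈ P kⁿ` and a hyperplane `hyperplane v ∈ Gr_{n-1}(kⁿ)` with `line v ⊄ hyperplane v`, and
for every edge the line of each end lies in the hyperplane of the other end.
(The equation `finrank + 1 = n` says that the dimension is `n - 1`, without truncated
subtraction.) -/
structure SimpleGraph.SpanColouring {V : Type*} (k : Type*) [Field k] (G : SimpleGraph V)
    (n : ℕ) where
  line : V → Submodule k (Fin n → k)
  hyperplane : V → Submodule k (Fin n → k)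
  finrank_line : ∀ v, Module.finrank k (line v) = 1
  finrank_hyperplane : ∀ v, Module.finrank k (hyperplane v) + 1 = n
  not_line_le_hyperplane : ∀ v, ¬ line v ≤ hyperplane v
  le_of_adj : ∀ v w, G.Adj v w → line v ≤ hyperplane w ∧ line w ≤ hyperplane v

/-- The span chromatic number of `G` over `k`: the least `n` such that `G` has an `n`-span
colouring (`⊤` if there is none, which does not happen for finite graphs). -/
noncomputable def SimpleGraph.spanChromaticNumber {V : Type*} (k : Type*) [Field k]
    (G : SimpleGraph V) : ℕ∞ :=
  ⨅ n ∈ {n : ℕ | Nonempty (G.SpanColouring k n)}, (n : ℕ∞)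

/-! ### Joins and Stanley-Reisner rings -/

/-- The join of two abstract simplicial complexes, on the disjoint union of the vertex sets. The
empty simplex is not listed among the faces in Mathlib's convention, so it is added by hand. -/
def AbstractSimplicialComplex.join {V W : Type*} (K : AbstractSimplicialComplex V)
    (L : AbstractSimplicialComplex W) : AbstractSimplicialComplex (V ⊕ W) where
  faces := {s | s.Nonempty ∧ (s.toLeft = ∅ ∨ s.toLeft ∈ K.faces) ∧
    (s.toRight = ∅ ∨ s.toRight ∈ L.faces)}
  isRelLowerSet_faces := by
    rintro s ⟨hs, hl, hr⟩
    refine ⟨hs, fun t hts ht => ⟨ht, ?_, ?_⟩⟩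
    · have hsub := Finset.toLeft_subset_toLeft hts
      rcases hl with h | h
      · exact Or.inl (Finset.subset_empty.mp (h ▸ hsub))
      · rcases t.toLeft.eq_empty_or_nonempty with h0 | h0
        · exact Or.inl h0
        · exact Or.inr ((K.isRelLowerSet_faces h).2 hsub h0)
    · have hsub := Finset.toRight_subset_toRight hts
      rcases hr with h | h
      · exact Or.inl (Finset.subset_empty.mp (h ▸ hsub))
      · rcases t.toRight.eq_empty_or_nonempty with h0 | h0
        · exact Or.inl h0
        · exact Or.inr ((L.isRelLowerSet_faces h).2 hsub h0)
  singleton_mem := by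
    rintro (v | w)
    · refine ⟨Finset.singleton_nonempty _, Or.inr ?_, Or.inl ?_⟩
      · have : ({Sum.inl v} : Finset (V ⊕ W)).toLeft = {v} := by ext; simp
        rw [this]; exact K.singleton_mem v
      · ext; simp
    · refine ⟨Finset.singleton_nonempty _, Or.inl ?_, Or.inr ?_⟩
      · ext; simp
      · have : ({Sum.inr w} : Finset (V ⊕ W)).toRight = {w} := by ext; simp
        rw [this]; exact L.singleton_mem w

/-- The ideal `I_K ⊆ ℤ[V]` generated by the square-free monomials of the non-faces of `K`.
(The empty set counts as a face.) -/
noncomputable def AbstractSimplicialComplex.stanleyReisnerIdeal {V : Type*} (K : AbstractSimplicialComplex V) :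
    Ideal (MvPolynomial V ℤ) :=
  Ideal.span {p | ∃ s : Finset V, s.Nonempty ∧ s ∉ K.faces ∧ p = ∏ v ∈ s, MvPolynomial.X v}

/-- The Stanley-Reisner ring `ℤ[V] / I_K`. -/
noncomputable abbrev AbstractSimplicialComplex.StanleyReisner {V : Type*} (K : AbstractSimplicialComplex V) :
    Type _ :=
  MvPolynomial V ℤ ⧸ K.stanleyReisnerIdeal

/-- The grading of the Stanley-Reisner ring in which the vertex `v` has degree `φ v`: the part of
degree `d` is the image of the weighted homogeneous polynomials of weighted degree `d`. -/
noncomputable def AbstractSimplicialComplex.srGrading {V : Type*} (K : AbstractSimplicialComplex V) (φ : V → ℕ)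
    (d : ℕ) : Submodule ℤ K.StanleyReisner :=
  (MvPolynomial.weightedHomogeneousSubmodule ℤ φ d).map
    (Ideal.Quotient.mkₐ ℤ K.stanleyReisnerIdeal).toLinearMap

namespace AbstractSimplicialComplex

variable {V : Type*} (K : AbstractSimplicialComplex V) (φ : V → ℕ)

instance : SetLike.GradedMonoid (K.srGrading φ) where
  one_mem := ⟨1, MvPolynomial.isWeightedHomogeneous_one ℤ φ,
    map_one (Ideal.Quotient.mkₐ ℤ K.stanleyReisnerIdeal)⟩
  mul_mem := by
    rintro i j _ _ ⟨p, hp, rfl⟩ ⟨q, hq, rfl⟩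
    exact ⟨p * q, MvPolynomial.IsWeightedHomogeneous.mul hp hq,
      map_mul (Ideal.Quotient.mkₐ ℤ K.stanleyReisnerIdeal) p q⟩

/-- The class of the variable of a vertex. -/
noncomputable def srVar (v : V) : K.StanleyReisner :=
  Ideal.Quotient.mkₐ ℤ K.stanleyReisnerIdeal (MvPolynomial.X v)

theorem srVar_mem (v : V) : K.srVar v ∈ K.srGrading φ (φ v) :=
  ⟨MvPolynomial.X v, MvPolynomial.isWeightedHomogeneous_X ℤ φ v, rfl⟩

/-- The homogeneous element of the direct sum that belongs to the variable of a vertex. -/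
noncomputable def srGen (v : V) : ⨁ i, K.srGrading φ i :=
  DirectSum.of (fun i => K.srGrading φ i) (φ v) ⟨K.srVar v, K.srVar_mem φ v⟩

theorem aeval_srGen_monomial (d : V →₀ ℕ) :
    ∃ h : Ideal.Quotient.mkₐ ℤ K.stanleyReisnerIdeal (MvPolynomial.monomial d 1) ∈
        K.srGrading φ (Finsupp.weight φ d),
      MvPolynomial.aeval (K.srGen φ) (MvPolynomial.monomial d (1 : ℤ)) =
        DirectSum.of (fun i => K.srGrading φ i) (Finsupp.weight φ d) ⟨_, h⟩ := by
  have hmem : ∀ e : V →₀ ℕ,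
      Ideal.Quotient.mkₐ ℤ K.stanleyReisnerIdeal (MvPolynomial.monomial e 1) ∈
        K.srGrading φ (Finsupp.weight φ e) := fun e =>
    ⟨_, MvPolynomial.isWeightedHomogeneous_monomial φ e 1 rfl, rfl⟩
  have hadd : ∀ e f : V →₀ ℕ,
      (MvPolynomial.aeval (K.srGen φ) (MvPolynomial.monomial e (1 : ℤ)) =
        DirectSum.of (fun i => K.srGrading φ i) (Finsupp.weight φ e) ⟨_, hmem e⟩) →
      (MvPolynomial.aeval (K.srGen φ) (MvPolynomial.monomial f (1 : ℤ)) =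
        DirectSum.of (fun i => K.srGrading φ i) (Finsupp.weight φ f) ⟨_, hmem f⟩) →
      MvPolynomial.aeval (K.srGen φ) (MvPolynomial.monomial (e + f) (1 : ℤ)) =
        DirectSum.of (fun i => K.srGrading φ i) (Finsupp.weight φ (e + f)) ⟨_, hmem (e + f)⟩ := by
    intro e f he hf
    have hm : MvPolynomial.monomial (e + f) (1 : ℤ) =
        MvPolynomial.monomial e 1 * MvPolynomial.monomial f 1 := by
      rw [MvPolynomial.monomial_mul, one_mul]
    refine (congrArg (MvPolynomial.aeval (K.srGen φ)) hm).trans ?_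
    rw [map_mul, he, hf, DirectSum.of_mul_of]
    apply DirectSum.of_eq_of_gradedMonoid_eq
    refine Sigma.subtype_ext ?_ ?_
    · exact (map_add _ _ _).symm
    · exact ((congrArg (Ideal.Quotient.mkₐ ℤ K.stanleyReisnerIdeal) hm).trans
        (map_mul (Ideal.Quotient.mkₐ ℤ K.stanleyReisnerIdeal) _ _)).symm
  refine ⟨hmem d, ?_⟩
  have hzero : MvPolynomial.aeval (K.srGen φ) (MvPolynomial.monomial (0 : V →₀ ℕ) (1 : ℤ)) =
      DirectSum.of (fun i => K.srGrading φ i) (Finsupp.weight φ 0) ⟨_, hmem 0⟩ := by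
    have h1 : MvPolynomial.monomial (0 : V →₀ ℕ) (1 : ℤ) = 1 := rfl
    refine (congrArg (MvPolynomial.aeval (K.srGen φ)) h1).trans ?_
    rw [map_one, DirectSum.one_def]
    apply DirectSum.of_eq_of_gradedMonoid_eq
    refine Sigma.subtype_ext ?_ ?_
    · exact (map_zero _).symm
    · exact (map_one (Ideal.Quotient.mkₐ ℤ K.stanleyReisnerIdeal)).symm
  have hone : ∀ v, MvPolynomial.aeval (K.srGen φ)
      (MvPolynomial.monomial (Finsupp.single v 1) (1 : ℤ)) =
      DirectSum.of (fun i => K.srGrading φ i) (Finsupp.weight φ (Finsupp.single v 1))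
        ⟨_, hmem (Finsupp.single v 1)⟩ := by
    intro v
    have h1 : MvPolynomial.monomial (Finsupp.single v 1) (1 : ℤ) = MvPolynomial.X v := rfl
    refine (congrArg (MvPolynomial.aeval (K.srGen φ)) h1).trans ?_
    rw [MvPolynomial.aeval_X, srGen]
    apply DirectSum.of_eq_of_gradedMonoid_eq
    refine Sigma.subtype_ext ?_ rfl
    change φ v = Finsupp.weight φ (Finsupp.single v 1)
    rw [Finsupp.weight_single, one_smul]
  induction d using Finsupp.induction_linear with
  | zero => exact hzero
  | add e f he hf => exact hadd e f he hf
  | single v k =>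
    induction k with
    | zero =>
      rw [Finsupp.single_zero]
      exact hzero
    | succ k ih =>
      rw [Finsupp.single_add]
      exact hadd _ _ ih (hone v)

/-- The decomposition of an element of the Stanley-Reisner ring into homogeneous parts. -/
noncomputable def srDecompose : K.StanleyReisner →ₐ[ℤ] ⨁ i, K.srGrading φ i :=
  Ideal.Quotient.liftₐ K.stanleyReisnerIdeal (MvPolynomial.aeval (K.srGen φ)) (by
    have hle : K.stanleyReisnerIdeal ≤
        RingHom.ker (MvPolynomial.aeval (R := ℤ) (K.srGen φ)) := by
      refine Ideal.span_le.mpr ?_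
      rintro _ ⟨s, hs, hK, rfl⟩
      have hm : ∏ v ∈ s, (MvPolynomial.X v : MvPolynomial V ℤ) =
          MvPolynomial.monomial (∑ v ∈ s, Finsupp.single v 1) 1 := by
        rw [MvPolynomial.monomial_sum_one]; rfl
      obtain ⟨h, e⟩ := K.aeval_srGen_monomial φ (∑ v ∈ s, Finsupp.single v 1)
      rw [SetLike.mem_coe, RingHom.mem_ker, hm, e]
      have h0 : Ideal.Quotient.mkₐ ℤ K.stanleyReisnerIdeal
          (MvPolynomial.monomial (∑ v ∈ s, Finsupp.single v 1) 1) = 0 :=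
        Ideal.Quotient.eq_zero_iff_mem.mpr (Ideal.subset_span ⟨s, hs, hK, hm.symm⟩)
      have h1 : (⟨_, h⟩ : K.srGrading φ (Finsupp.weight φ (∑ v ∈ s, Finsupp.single v 1))) = 0 :=
        Subtype.ext h0
      rw [h1, map_zero]
    exact fun p hp => hle hp)

/-- The Stanley-Reisner ring is a graded algebra. -/
noncomputable instance : GradedAlgebra (K.srGrading φ) :=
  GradedAlgebra.ofAlgHom _ (K.srDecompose φ)
    (by
      apply Ideal.Quotient.algHom_ext
      apply MvPolynomial.algHom_ext
      intro v
      change DirectSum.coeAlgHom (K.srGrading φ)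
        (MvPolynomial.aeval (K.srGen φ) (MvPolynomial.X v)) = K.srVar v
      rw [MvPolynomial.aeval_X, srGen]
      exact DirectSum.coeAlgHom_of _ _ _)
    (by
      rintro i ⟨_, p, hp, rfl⟩
      have hterm : ∀ d ∈ p.support, Finsupp.weight φ d = i := fun d hd =>
        hp (MvPolynomial.mem_support_iff.mp hd)
      have hmem : ∀ d : p.support,
          Ideal.Quotient.mkₐ ℤ K.stanleyReisnerIdeal (MvPolynomial.monomial d.1 1) ∈
            K.srGrading φ i := fun d =>
        ⟨_, MvPolynomial.isWeightedHomogeneous_monomial φ d.1 1 (hterm d.1 d.2), rfl⟩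
      have hsum : p = ∑ d ∈ p.support.attach,
          p.coeff d.1 • MvPolynomial.monomial d.1 (1 : ℤ) := by
        rw [Finset.sum_attach p.support
          (fun d => p.coeff d • MvPolynomial.monomial d (1 : ℤ))]
        conv_lhs => rw [p.as_sum]
        refine Finset.sum_congr rfl fun d _ => ?_
        rw [MvPolynomial.smul_monomial, smul_eq_mul, mul_one]
      have hL : ∀ d : p.support,
          MvPolynomial.aeval (K.srGen φ) (MvPolynomial.monomial d.1 (1 : ℤ)) =
            DirectSum.of (fun i => K.srGrading φ i) i ⟨_, hmem d⟩ := by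
        intro d
        obtain ⟨h, e⟩ := K.aeval_srGen_monomial φ d.1
        rw [e]
        apply DirectSum.of_eq_of_gradedMonoid_eq
        exact Sigma.subtype_ext (hterm d.1 d.2) rfl
      have hR : (⟨Ideal.Quotient.mkₐ ℤ K.stanleyReisnerIdeal p, p, hp, rfl⟩ : K.srGrading φ i) =
          ∑ d ∈ p.support.attach, p.coeff d.1 • (⟨_, hmem d⟩ : K.srGrading φ i) := by
        apply Subtype.ext
        rw [AddSubmonoidClass.coe_finsetSum]
        change Ideal.Quotient.mkₐ ℤ K.stanleyReisnerIdeal p = _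
        conv_lhs => rw [hsum]
        rw [map_sum]
        exact Finset.sum_congr rfl fun d _ => map_zsmul _ _ _
      have hP : MvPolynomial.aeval (K.srGen φ) p =
          ∑ d ∈ p.support.attach, p.coeff d.1 •
            DirectSum.of (fun i => K.srGrading φ i) i ⟨_, hmem d⟩ := by
        conv_lhs => rw [hsum]
        rw [map_sum]
        refine Finset.sum_congr rfl fun d _ => ?_
        rw [map_zsmul, hL]
      refine Eq.trans hP ?_
      refine Eq.trans ?_ (congrArg (DirectSum.of (fun i => K.srGrading φ i) i) hR.symm)
      rw [map_sum]
      exact Finset.sum_congr rfl fun d _ => (map_zsmul _ _ _).symm)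

end AbstractSimplicialComplex

/-- The complex `Δ^{n-1} ∗ L`; its vertices are `x_1, …, x_n` (left) and the vertices of `L`
(right). -/
def simplexJoin {V : Type*} (n : ℕ) (L : AbstractSimplicialComplex V) :
    AbstractSimplicialComplex (Fin n ⊕ V) :=
  (⊤ : AbstractSimplicialComplex (Fin n)).join L

/-- The degree function `φ(x_i) = 4`, `φ(y) = 6` for `y ∈ V(L)`. -/
def degree46 (n : ℕ) (V : Type*) : Fin n ⊕ V → ℕ :=
  Sum.elim (fun _ => 4) (fun _ => 6)

/-- The ring `A(n, L) = SR(Δ^{n-1} ∗ L, φ)`. -/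
noncomputable abbrev AlgA {V : Type*} (n : ℕ) (L : AbstractSimplicialComplex V) : Type _ :=
  (simplexJoin n L).StanleyReisner

/-- The grading of `A(n, L)`. -/
noncomputable abbrev AlgA.grading {V : Type*} (n : ℕ) (L : AbstractSimplicialComplex V) :
    ℕ → Submodule ℤ (AlgA n L) :=
  (simplexJoin n L).srGrading (degree46 n V)

/-- The algebra `A(n, L) ⊗ ℤ/2` over `ℤ/2`. -/
noncomputable abbrev AlgA.ModTwo {V : Type*} (n : ℕ) (L : AbstractSimplicialComplex V) : Type _ :=
  ZMod 2 ⊗[ℤ] AlgA n L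

/-- The induced grading of `A(n, L) ⊗ ℤ/2`. -/
noncomputable abbrev AlgA.gradingModTwo {V : Type*} (n : ℕ) (L : AbstractSimplicialComplex V) :
    ℕ → Submodule (ZMod 2) (AlgA.ModTwo n L) :=
  fun d => (AlgA.grading n L d).baseChange (ZMod 2)

/-! ### The mod-2 Steenrod algebra and its unstable actions -/

/-- The relations of the mod-2 Steenrod algebra between the free generators `Sq^i`, `i ≥ 0`:
`Sq^0 = 1` and the Adem relations
`Sq^i Sq^j = ∑_{k=0}^{⌊i/2⌋} C(j-k-1, i-2k) Sq^{i+j-k} Sq^k` for `0 < i < 2j`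
(no subtraction below is truncated, as `2k ≤ i < 2j`). -/
inductive SteenrodRel : FreeAlgebra (ZMod 2) ℕ → FreeAlgebra (ZMod 2) ℕ → Prop
  | sq_zero : SteenrodRel (FreeAlgebra.ι (ZMod 2) 0) 1
  | adem (i j : ℕ) (hi : 0 < i) (hij : i < 2 * j) :
      SteenrodRel (FreeAlgebra.ι (ZMod 2) i * FreeAlgebra.ι (ZMod 2) j)
        (∑ k ∈ Finset.range (i / 2 + 1),
          ((j - k - 1).choose (i - 2 * k) : ZMod 2) •
            (FreeAlgebra.ι (ZMod 2) (i + j - k) * FreeAlgebra.ι (ZMod 2) k))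

/-- The mod-2 Steenrod algebra `𝒜₂`. -/
abbrev SteenrodAlgebra : Type := RingQuot SteenrodRel

/-- The Steenrod square `Sq^i`. -/
noncomputable def SteenrodAlgebra.Sq (i : ℕ) : SteenrodAlgebra :=
  RingQuot.mkAlgHom (ZMod 2) SteenrodRel (FreeAlgebra.ι (ZMod 2) i)

/-- An unstable action of the mod-2 Steenrod algebra on a commutative graded `ℤ/2`-algebra: a
graded module structure satisfying the Cartan formula and the unstable condition. -/
structure UnstableSteenrodAction {A : Type*} [CommRing A] [Algebra (ZMod 2) A]
    (𝒜 : ℕ → Submodule (ZMod 2) A) [GradedAlgebra 𝒜] where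
  act : SteenrodAlgebra →ₐ[ZMod 2] Module.End (ZMod 2) A
  degree : ∀ (k d : ℕ) (a : A), a ∈ 𝒜 d → act (SteenrodAlgebra.Sq k) a ∈ 𝒜 (d + k)
  cartan : ∀ (k : ℕ) (a b : A), act (SteenrodAlgebra.Sq k) (a * b) =
    ∑ i ∈ Finset.range (k + 1),
      act (SteenrodAlgebra.Sq i) a * act (SteenrodAlgebra.Sq (k - i)) b
  unstable_eq : ∀ (d : ℕ) (a : A), a ∈ 𝒜 d → act (SteenrodAlgebra.Sq d) a = a ^ 2
  unstable_gt : ∀ (k d : ℕ) (a : A), a ∈ 𝒜 d → d < k → act (SteenrodAlgebra.Sq k) a = 0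

/-!
Write `x_i` for the generators of degree 4 and `y_v` for those of degree 6, and describe a span
colouring over `ℤ/2` by vectors `ℓ_v` that span the lines and linear forms `f_v` that cut out
the hyperplanes: `f_v(ℓ_v) = 1`, and `f_v(ℓ_w) = 0` for every edge `vw`
(`SimpleGraph.spanChromaticNumber_le_iff`). The theorem then says that unstable actions exist if
and only if such vectors and forms exist in dimension `n`.

*From colourings to actions.* The vector `ℓ_v` is regarded as a linear form in the `x_i`, and
`f_v` as the coefficient of `y_v` in `Sq²`. The total square `P : A → A[T]` is the ring
homomorphism `x_i ↦ x_i + T² ∑_v f_v(x_i) y_v + T⁴ x_i²`, `y_v ↦ y_v (1 + T⁴ ℓ_v + T⁶ y_v)`; on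
the face of an edge this is the action on the cohomology of `BSU(3) × BSU(3) × BSp(1)^{n-2}`.
The Cartan formula holds because `P` is multiplicative, and the unstable condition passes from
the generators to monomials. The Adem relations are deduced from the Bullett-Macdonald identity
`P(w(s² + s)) P(w) = P(w(1 + s)) P(ws²)`, which is an equality of ring homomorphisms and hence
has to be checked on the generators only. The deduction (`TotalSquare.adem_of_bullettMacdonald`)
is a residue computation: one multiplies by `(1 + s)^{-(a+1)}` and takes the coefficient of
`sᵃ`. On a generator, both sides of the identity are polynomials in two quantities that take the
same values on both sides (`TotalSquare.quaternionic_normalForm`,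
`TotalSquare.chern_normalForm`); for `y_v` this uses `y_v Sq² ℓ_v = y_v²`, which is the duality
of the colouring.

*From actions to colourings.* For degree reasons `Sq² x_i = ∑_v F_{iv} y_v` and `Sq⁴ y_v =
∑_{i,w} q^v_{iw} x_i y_w`. Let `f_v` be the form with coefficients `F_{iv}` and `ℓ_v` the vector
with entries `q^v_{iv}`. Comparing coefficients in `y_v² = Sq⁶ y_v = Sq² Sq⁴ y_v` gives
`f_v(ℓ_v) = 1`, and for every edge `vw` also `f_w(ℓ_v) + f_v(q^v_w) = 0` and `f_w(q^v_w) = 0`.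
If `w` has a neighbour `u ≠ v`, then `y_v y_w y_u = 0`, and the coefficient of `x_i y_w² y_u` in
its `Sq⁴` shows that `q^v_w = 0`. So the colouring can fail to be dual only at leaves `w`
attached to `v`. The relations still imply `f_v ≠ f_w`, which leaves room to choose a new line
and hyperplane for such a leaf (`SimpleGraph.exists_isDualColouring`).

The arguments are carried out in an abstract graded algebra with the universal property of the
Stanley-Reisner algebra (`AbstractSimplicialComplex.IsModTwoPresentation`).
-/

/-! ### The Adem relations from the Bullett-Macdonald identity -/

open Polynomial in
theorem Polynomial.coeff_eval₂_C_mul_X {R S : Type*} [CommSemiring R] [CommSemiring S]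
    (f : R →+* S[X]) (v : S) (p : R[X]) (N : ℕ) :
    (p.eval₂ f (C v * X)).coeff N =
      ∑ x ∈ Finset.HasAntidiagonal.antidiagonal N, (f (p.coeff x.2)).coeff x.1 * v ^ x.2 := by
  induction p using Polynomial.induction_on' with
  | add p q hp hq =>
    simp only [eval₂_add, coeff_add, hp, hq, map_add, add_mul, Finset.sum_add_distrib]
  | monomial k a =>
    rw [eval₂_monomial, mul_pow, ← mul_assoc, coeff_mul_X_pow']
    split_ifs with h
    · rw [Finset.sum_eq_single (N - k, k)]
      · simp only [coeff_monomial, if_true]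
        rw [← C_pow, coeff_mul_C]
      · rintro ⟨i, j⟩ hij hne
        have : k ≠ j := by
          rintro rfl
          apply hne
          have := Finset.HasAntidiagonal.mem_antidiagonal.mp hij
          ext <;> simp; omega
        simp [coeff_monomial, this]
      · intro h'
        exact absurd (Finset.HasAntidiagonal.mem_antidiagonal.mpr (Nat.sub_add_cancel h)) h'
    · symm
      apply Finset.sum_eq_zero
      rintro ⟨i, j⟩ hij
      have : k ≠ j := by
        rintro rfl
        have := Finset.HasAntidiagonal.mem_antidiagonal.mp hij
        simp only at this
        omega
      simp [coeff_monomial, this]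

namespace TotalSquare

open Polynomial

variable {A : Type*} [CommRing A]

/-- For `P : A → A[T]`, written `P(a) = ∑ Tⁱ Sqⁱ a`, and an element `α` of an `A`-algebra `B`, the
homomorphism `P_α : a ↦ ∑ αⁱ Sqⁱ a`. -/
noncomputable def evalAt (P : A →+* A[X]) {B : Type*} [CommRing B] [Algebra A B] (α : B) :
    A →+* B :=
  (eval₂RingHom (algebraMap A B) α).comp P

/-- The composite `P_α P_β : a ↦ ∑ αⁱ βʲ Sqⁱ Sqʲ a`. -/
noncomputable def evalAt₂ (P : A →+* A[X]) {B : Type*} [CommRing B] [Algebra A B] (α β : B) :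
    A →+* B :=
  (eval₂RingHom (evalAt P α) β).comp P

theorem evalAt_apply (P : A →+* A[X]) {B : Type*} [CommRing B] [Algebra A B] (α : B) (a : A) :
    evalAt P α a = (P a).eval₂ (algebraMap A B) α := rfl

theorem evalAt₂_apply (P : A →+* A[X]) {B : Type*} [CommRing B] [Algebra A B] (α β : B)
    (a : A) : evalAt₂ P α β a = (P a).eval₂ (evalAt P α) β := rfl

theorem coeff_evalAt₂ (P : A →+* A[X]) (u v : PowerSeries A) (a : A) (N : ℕ) :
    (evalAt₂ P (C u * X : (PowerSeries A)[X]) (C v * X) a).coeff N =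
      ∑ x ∈ Finset.HasAntidiagonal.antidiagonal N,
        PowerSeries.C ((P ((P a).coeff x.2)).coeff x.1) * (u ^ x.1 * v ^ x.2) := by
  rw [evalAt₂_apply, Polynomial.coeff_eval₂_C_mul_X]
  refine Finset.sum_congr rfl fun x _ => ?_
  rw [evalAt_apply, Polynomial.coeff_eval₂_C_mul_X, Finset.sum_eq_single (0, x.1)]
  · have : algebraMap A (PowerSeries A)[X] ((P ((P a).coeff x.2)).coeff x.1) =
        C (PowerSeries.C ((P ((P a).coeff x.2)).coeff x.1)) := rfl
    rw [this, coeff_C_zero]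
    ring
  · rintro ⟨i, j⟩ hij hne
    have : algebraMap A (PowerSeries A)[X] ((P ((P a).coeff x.2)).coeff j) =
        C (PowerSeries.C ((P ((P a).coeff x.2)).coeff j)) := rfl
    simp only [this]
    rw [coeff_C, if_neg, zero_mul]
    rintro rfl
    apply hne
    have := Finset.HasAntidiagonal.mem_antidiagonal.mp hij
    simp only [zero_add] at this
    rw [this]
  · intro h
    exact absurd (Finset.HasAntidiagonal.mem_antidiagonal.mpr (zero_add _)) h

end TotalSquare

namespace PowerSeries

variable (R : Type*) [CommRing R] [CharP R 2]

/-- The coefficient of `s^{a-i}` in `(1+s)^{-(a-i+1)}` is the binomial coefficient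
`C(2(a-i), a-i)`, which is even unless `i = a`. -/
theorem coeff_mul_invOneSubPow_pow (a i : ℕ) :
    coeff a ((X ^ 2 + X : R⟦X⟧) ^ i * (invOneSubPow R (a + 1)).val) = if i = a then 1 else 0 := by
  have h : (X ^ 2 + X : R⟦X⟧) = X * (1 - X) := by
    have : (2 : R⟦X⟧) = 0 := by
      have := CharP.cast_eq_zero R 2
      rw [← map_ofNat (C (R := R)) 2]
      simpa using congrArg (C (R := R)) this
    linear_combination X ^ 2 * this
  rw [h, mul_pow, mul_assoc, coeff_X_pow_mul']
  split_ifs with h1 h2 h2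
  · subst h2
    rw [add_comm, one_sub_pow_mul_invOneSubPow_val_add_eq_invOneSubPow_val]
    simp [invOneSubPow_val_succ_eq_mk_add_choose]
  · obtain ⟨m, rfl⟩ := Nat.exists_eq_add_of_le h1
    rw [show i + m + 1 = (m + 1) + i by ring,
      one_sub_pow_mul_invOneSubPow_val_add_eq_invOneSubPow_val,
      invOneSubPow_val_succ_eq_mk_add_choose, Nat.add_sub_cancel_left, coeff_mk, ← two_mul,
      ← Nat.centralBinom, CharP.cast_eq_zero_iff R 2]
    exact Nat.two_dvd_centralBinom_of_one_le (by omega)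
  · omega
  · rfl

/-- The binomial coefficients of the Adem relations. The hypothesis `hk` makes the exponent
`N - k - (a + 1)` of `1 + s` non-negative where it matters. -/
theorem coeff_mul_invOneSubPow_adem (a N k : ℕ) (hkN : k ≤ N) (hk : 2 * k ≤ a → a + 1 + k ≤ N) :
    coeff a ((1 + X : R⟦X⟧) ^ (N - k) * (X ^ 2) ^ k * (invOneSubPow R (a + 1)).val) =
      if 2 * k ≤ a then ((N - k - (a + 1)).choose (a - 2 * k) : R) else 0 := by
  have h : (1 + X : R⟦X⟧) = 1 - X := by
    have : (2 : R⟦X⟧) = 0 := by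
      have := CharP.cast_eq_zero R 2
      rw [← map_ofNat (C (R := R)) 2]
      simpa using congrArg (C (R := R)) this
    linear_combination X * this
  rw [← pow_mul, mul_comm _ (X ^ (2 * k)), mul_assoc, coeff_X_pow_mul']
  split_ifs with h1
  · obtain ⟨m, hm⟩ := Nat.exists_eq_add_of_le (hk h1)
    have e : N - k = m + (a + 1) := by omega
    rw [e, h, one_sub_pow_add_mul_invOneSubPow_val_eq_one_sub_pow, ← h, Nat.add_sub_cancel]
    have : (1 + X : R⟦X⟧) ^ m = ((1 + Polynomial.X : Polynomial R) ^ m : Polynomial R) := by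
      simp
    rw [this, Polynomial.coeff_coe, Polynomial.coeff_one_add_X_pow]
  · rfl

end PowerSeries

namespace TotalSquare

open Polynomial

variable {A : Type*} [CommRing A] [CharP A 2]

/-- The Adem relations follow from the Bullett-Macdonald identity
`P(w(s² + s)) P(w) = P(w(1 + s)) P(ws²)`: in the coefficient of `w^{i+j}`, which is an identity of
power series in `s`, multiply by `(1 + s)^{-(i+1)}` and take the coefficient of `sⁱ`. -/
theorem adem_of_bullettMacdonald (P : A →+* A[X])
    (hP : evalAt₂ P (C (PowerSeries.X ^ 2 + PowerSeries.X) * X : (PowerSeries A)[X]) X =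
      evalAt₂ P (C (1 + PowerSeries.X) * X) (C (PowerSeries.X ^ 2) * X))
    (i j : ℕ) (hij : i < 2 * j) (a : A) :
    (P ((P a).coeff j)).coeff i = ∑ k ∈ Finset.range (i / 2 + 1),
      ((j - k - 1).choose (i - 2 * k) : A) * (P ((P a).coeff k)).coeff (i + j - k) := by
  have h1 := congrArg (fun p : (PowerSeries A)[X] => PowerSeries.coeff i
    (p.coeff (i + j) * (PowerSeries.invOneSubPow A (i + 1)).val)) (DFunLike.congr_fun hP a)
  have h2 : evalAt₂ P (C (PowerSeries.X ^ 2 + PowerSeries.X) * X : (PowerSeries A)[X]) X =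
      evalAt₂ P (C (PowerSeries.X ^ 2 + PowerSeries.X) * X) (C 1 * X) := by
    rw [C_1, one_mul]
  simp only [h2, coeff_evalAt₂, Finset.sum_mul, map_sum, mul_assoc, PowerSeries.coeff_C_mul] at h1
  simp only [one_pow, one_mul, PowerSeries.coeff_mul_invOneSubPow_pow] at h1
  rw [Finset.sum_eq_single (i, j)] at h1
  · rw [if_pos rfl, mul_one] at h1
    rw [h1, Finset.Nat.sum_antidiagonal_eq_sum_range_succ_mk, ← Finset.sum_range_reflect]
    simp only [Nat.add_sub_cancel, Nat.succ_eq_add_one]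
    have hle : i / 2 + 1 ≤ i + j + 1 := by omega
    symm
    rw [← Finset.sum_subset (Finset.range_mono hle)]
    · refine Finset.sum_congr rfl fun k hk => ?_
      have hk' := Finset.mem_range.mp hk
      rw [← mul_assoc ((1 + PowerSeries.X) ^ _), show i + j - (i + j - k) = k by omega,
        PowerSeries.coeff_mul_invOneSubPow_adem A _ _ _ (by omega) (by omega), if_pos (by omega),
        show i + j - k - (i + 1) = j - k - 1 by omega, mul_comm]
    · intro k hk hk'
      rw [Finset.mem_range] at hk hk'
      rw [← mul_assoc ((1 + PowerSeries.X) ^ _), show i + j - (i + j - k) = k by omega,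
        PowerSeries.coeff_mul_invOneSubPow_adem A _ _ _ (by omega) (by omega), if_neg (by omega),
        mul_zero]
  · rintro ⟨i', j'⟩ h hne
    rw [if_neg, mul_zero]
    rintro rfl
    apply hne
    have := Finset.HasAntidiagonal.mem_antidiagonal.mp h
    ext <;> simp at this ⊢
    omega
  · intro h
    simp at h

end TotalSquare

/-! ### Unstable actions from total squares -/

namespace TotalSquare

open Polynomial

variable {A : Type*} [CommRing A] [Algebra (ZMod 2) A]

/-- The linear endomorphism `Sqⁱ` read off from a total square. -/
noncomputable def square (P : A →ₐ[ZMod 2] A[X]) (i : ℕ) : Module.End (ZMod 2) A where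
  toFun a := (P a).coeff i
  map_add' a b := by simp
  map_smul' c a := by simp

@[simp]
theorem square_apply (P : A →ₐ[ZMod 2] A[X]) (i : ℕ) (a : A) : square P i a = (P a).coeff i := rfl

/-- The action of the Steenrod algebra defined by a total square with `Sq⁰ = 1` that satisfies the
Bullett-Macdonald identity. -/
noncomputable def steenrodHom [CharP A 2] (P : A →ₐ[ZMod 2] A[X])
    (h0 : ∀ a, (P a).coeff 0 = a)
    (hBM : evalAt₂ (P : A →+* A[X])
        (C (PowerSeries.X ^ 2 + PowerSeries.X) * X : (PowerSeries A)[X]) X =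
      evalAt₂ (P : A →+* A[X]) (C (1 + PowerSeries.X) * X) (C (PowerSeries.X ^ 2) * X)) :
    SteenrodAlgebra →ₐ[ZMod 2] Module.End (ZMod 2) A :=
  RingQuot.liftAlgHom (ZMod 2) ⟨FreeAlgebra.lift (ZMod 2) (square P), by
    intro x y hxy
    induction hxy with
    | sq_zero =>
      ext a
      simp [h0]
    | adem i j hi hij =>
      ext a
      simp only [map_mul, map_sum, map_smul, FreeAlgebra.lift_ι_apply, LinearMap.sum_apply,
        LinearMap.smul_apply, Module.End.mul_apply, square_apply]
      refine (adem_of_bullettMacdonald (P : A →+* A[X]) hBM i j hij a).trans ?_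
      refine Finset.sum_congr rfl fun k _ => ?_
      rw [Algebra.smul_def, map_natCast]
      rfl⟩

theorem steenrodHom_Sq [CharP A 2] (P : A →ₐ[ZMod 2] A[X]) (h0) (hBM) (i : ℕ) (a : A) :
    steenrodHom P h0 hBM (SteenrodAlgebra.Sq i) a = (P a).coeff i := by
  simp [steenrodHom, SteenrodAlgebra.Sq]

/-- The conditions that an unstable action puts on the total square of an element `a` of degree
`d`: `Sqᵏ a` has degree `d + k`, vanishes for `k > d`, and is `a²` for `k = d`. -/
structure IsUnstableAt (𝒜 : ℕ → Submodule (ZMod 2) A) (P : A →ₐ[ZMod 2] A[X]) (d : ℕ) (a : A) :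
    Prop where
  coeff_mem : ∀ k, (P a).coeff k ∈ 𝒜 (d + k)
  natDegree_le : (P a).natDegree ≤ d
  coeff_eq : (P a).coeff d = a ^ 2

namespace IsUnstableAt

variable {𝒜 : ℕ → Submodule (ZMod 2) A} {P : A →ₐ[ZMod 2] A[X]} {d e : ℕ} {a b : A}

theorem zero : IsUnstableAt 𝒜 P d 0 := ⟨by simp, by simp, by simp⟩

theorem add [CharP A 2] (ha : IsUnstableAt 𝒜 P d a) (hb : IsUnstableAt 𝒜 P d b) :
    IsUnstableAt 𝒜 P d (a + b) where
  coeff_mem k := by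
    rw [map_add, coeff_add]
    exact add_mem (ha.coeff_mem k) (hb.coeff_mem k)
  natDegree_le := by
    rw [map_add]
    exact (natDegree_add_le _ _).trans (max_le ha.natDegree_le hb.natDegree_le)
  coeff_eq := by
    rw [map_add, coeff_add, ha.coeff_eq, hb.coeff_eq, CharTwo.add_sq]

theorem smul [CharP A 2] (c : ZMod 2) (ha : IsUnstableAt 𝒜 P d a) :
    IsUnstableAt 𝒜 P d (c • a) := by
  obtain rfl | rfl : c = 0 ∨ c = 1 := by revert c; decide
  · rw [zero_smul]; exact zero
  · rwa [one_smul]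

theorem one [SetLike.GradedMonoid 𝒜] : IsUnstableAt 𝒜 P 0 1 where
  coeff_mem k := by
    rw [map_one, coeff_one]
    split_ifs with h
    · subst h; exact SetLike.one_mem_graded 𝒜
    · exact zero_mem _
  natDegree_le := by simp
  coeff_eq := by simp

theorem mul [SetLike.GradedMonoid 𝒜] (ha : IsUnstableAt 𝒜 P d a) (hb : IsUnstableAt 𝒜 P e b) :
    IsUnstableAt 𝒜 P (d + e) (a * b) where
  coeff_mem k := by
    rw [map_mul, coeff_mul]
    refine sum_mem fun x hx => ?_
    have hx' := Finset.HasAntidiagonal.mem_antidiagonal.mp hx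
    have h := SetLike.GradedMul.mul_mem (ha.coeff_mem x.1) (hb.coeff_mem x.2)
    rwa [show d + x.1 + (e + x.2) = d + e + k by omega] at h
  natDegree_le := by
    rw [map_mul]
    exact natDegree_mul_le.trans (add_le_add ha.natDegree_le hb.natDegree_le)
  coeff_eq := by
    rw [map_mul, coeff_mul_add_eq_of_natDegree_le ha.natDegree_le hb.natDegree_le, ha.coeff_eq,
      hb.coeff_eq, mul_pow]

theorem pow [SetLike.GradedMonoid 𝒜] (ha : IsUnstableAt 𝒜 P d a) (k : ℕ) :
    IsUnstableAt 𝒜 P (k * d) (a ^ k) := by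
  induction k with
  | zero => simpa using one
  | succ k ih => rw [pow_succ, Nat.succ_mul]; exact ih.mul ha

theorem prod [SetLike.GradedMonoid 𝒜] {ι : Type*} (s : Finset ι) {d : ι → ℕ} {a : ι → A}
    (h : ∀ i ∈ s, IsUnstableAt 𝒜 P (d i) (a i)) :
    IsUnstableAt 𝒜 P (∑ i ∈ s, d i) (∏ i ∈ s, a i) := by
  classical
  induction s using Finset.induction_on with
  | empty => simpa using one
  | insert i s hi ih =>
    rw [Finset.sum_insert hi, Finset.prod_insert hi]
    exact (h i (Finset.mem_insert_self i s)).mul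
      (ih fun j hj => h j (Finset.mem_insert_of_mem hj))

end IsUnstableAt

/-- A total square with `Sq⁰ = 1` that satisfies the Bullett-Macdonald identity and the unstable
condition defines an unstable action. The Cartan formula is the multiplicativity of `P`. -/
noncomputable def unstableAction [CharP A 2] (𝒜 : ℕ → Submodule (ZMod 2) A) [GradedAlgebra 𝒜]
    (P : A →ₐ[ZMod 2] A[X]) (h0 : ∀ a, (P a).coeff 0 = a)
    (hBM : evalAt₂ (P : A →+* A[X])
        (C (PowerSeries.X ^ 2 + PowerSeries.X) * X : (PowerSeries A)[X]) X =
      evalAt₂ (P : A →+* A[X]) (C (1 + PowerSeries.X) * X) (C (PowerSeries.X ^ 2) * X))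
    (hP : ∀ d, ∀ a ∈ 𝒜 d, IsUnstableAt 𝒜 P d a) :
    UnstableSteenrodAction 𝒜 where
  act := steenrodHom P h0 hBM
  degree k d a ha := by
    rw [steenrodHom_Sq]
    exact (hP d a ha).coeff_mem k
  cartan k a b := by
    simp only [steenrodHom_Sq]
    rw [map_mul, coeff_mul, Finset.Nat.sum_antidiagonal_eq_sum_range_succ_mk]
  unstable_eq d a ha := by
    rw [steenrodHom_Sq]
    exact (hP d a ha).coeff_eq
  unstable_gt k d a ha hk := by
    rw [steenrodHom_Sq]
    exact coeff_eq_zero_of_natDegree_lt ((hP d a ha).natDegree_le.trans_lt hk)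

end TotalSquare

/-! ### Presentation of the mod-2 Stanley-Reisner algebra -/

/-- A graded `ℤ/2`-algebra `A` with generators `gen` is presented as the mod-2 Stanley-Reisner
algebra of the complex `K`, with the vertex `v` in degree `φ v`. The universal property is stated
for rings in one universe `w`. -/
structure AbstractSimplicialComplex.IsModTwoPresentation.{w, u, t} {V : Type u}
    (K : AbstractSimplicialComplex V) (φ : V → ℕ) {A : Type t} [CommRing A] [Algebra (ZMod 2) A]
    (𝒜 : ℕ → Submodule (ZMod 2) A) (gen : V → A) : Prop where
  prod_gen_eq_zero : ∀ s : Finset V, s.Nonempty → s ∉ K.faces → ∏ v ∈ s, gen v = 0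
  exists_lift : ∀ (S : Type w) [CommRing S] [Algebra (ZMod 2) S] (g : V → S),
    (∀ s : Finset V, s.Nonempty → s ∉ K.faces → ∏ v ∈ s, g v = 0) →
      ∃ f : A →ₐ[ZMod 2] S, ∀ v, f (gen v) = g v
  ringHom_ext : ∀ (S : Type w) [CommRing S] (f g : A →+* S), (∀ v, f (gen v) = g (gen v)) → f = g
  grading_eq_span : ∀ d, 𝒜 d = Submodule.span (ZMod 2)
    {a | ∃ e : V →₀ ℕ, Finsupp.weight φ e = d ∧ a = e.prod fun v k => gen v ^ k}

namespace AlgA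

section Generators

variable {V : Type*} (n : ℕ) (L : AbstractSimplicialComplex V)

/-- The generator of `A(n, L) ⊗ ℤ/2` that belongs to a vertex of the join. -/
noncomputable def gen (v : Fin n ⊕ V) : ModTwo n L :=
  (1 : ZMod 2) ⊗ₜ[ℤ] (simplexJoin n L).srVar v

variable {n L}

theorem prod_gen_eq_zero (s : Finset (Fin n ⊕ V)) (hs : s.Nonempty)
    (h : s ∉ (simplexJoin n L).faces) : ∏ v ∈ s, gen n L v = 0 := by
  have h1 : ∏ v ∈ s, (simplexJoin n L).srVar v = 0 := by
    have : ∏ v ∈ s, (simplexJoin n L).srVar v =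
        Ideal.Quotient.mkₐ ℤ (simplexJoin n L).stanleyReisnerIdeal
          (∏ v ∈ s, MvPolynomial.X v) := by
      rw [map_prod]; rfl
    rw [this]
    exact Ideal.Quotient.eq_zero_iff_mem.mpr (Ideal.subset_span ⟨s, hs, h, rfl⟩)
  have h2 : ∏ v ∈ s, gen n L v = Algebra.TensorProduct.includeRight (R := ℤ) (A := ZMod 2)
      (∏ v ∈ s, (simplexJoin n L).srVar v) := by
    rw [map_prod]; rfl
  rw [h2, h1, map_zero]

/-- The homomorphism out of `A(n, L) ⊗ ℤ/2` with prescribed values on the generators. -/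
noncomputable def lift {S : Type*} [CommRing S] [Algebra (ZMod 2) S] (g : Fin n ⊕ V → S)
    (hg : ∀ s : Finset (Fin n ⊕ V), s.Nonempty → s ∉ (simplexJoin n L).faces →
      ∏ v ∈ s, g v = 0) : ModTwo n L →ₐ[ZMod 2] S :=
  Algebra.TensorProduct.lift (Algebra.ofId (ZMod 2) S)
    (Ideal.Quotient.liftₐ _ (MvPolynomial.aeval g) (by
      have hle : (simplexJoin n L).stanleyReisnerIdeal ≤
          RingHom.ker (MvPolynomial.aeval (R := ℤ) g) := by
        refine Ideal.span_le.mpr ?_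
        rintro _ ⟨s, hs, hK, rfl⟩
        rw [SetLike.mem_coe, RingHom.mem_ker, map_prod]
        simpa using hg s hs hK
      exact fun p hp => hle hp)) fun _ _ => Commute.all _ _

@[simp]
theorem lift_gen {S : Type*} [CommRing S] [Algebra (ZMod 2) S] (g : Fin n ⊕ V → S) (hg)
    (v : Fin n ⊕ V) : lift (L := L) g hg (gen n L v) = g v := by
  rw [lift, gen, Algebra.TensorProduct.lift_tmul, map_one, one_mul]
  change MvPolynomial.aeval g (MvPolynomial.X v) = g v
  rw [MvPolynomial.aeval_X]

theorem ringHom_ext {S : Type*} [CommRing S] {f g : ModTwo n L →+* S}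
    (h : ∀ v, f (gen n L v) = g (gen n L v)) : f = g := by
  apply Algebra.TensorProduct.ringHom_ext
  · exact Subsingleton.elim _ _
  · apply Ideal.Quotient.ringHom_ext
    apply MvPolynomial.ringHom_ext
    · intro r
      simp
    · exact h

/-- The monomials of weighted degree `d` span the part of degree `d`. -/
theorem gradingModTwo_eq_span (d : ℕ) :
    gradingModTwo n L d = Submodule.span (ZMod 2)
      {a | ∃ e : Fin n ⊕ V →₀ ℕ, Finsupp.weight (degree46 n V) e = d ∧
        a = e.prod fun v k => gen n L v ^ k} := by
  have hmon : ∀ e : Fin n ⊕ V →₀ ℕ, e.prod (fun v k => gen n L v ^ k) =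
      (1 : ZMod 2) ⊗ₜ[ℤ] Ideal.Quotient.mkₐ ℤ (simplexJoin n L).stanleyReisnerIdeal
        (MvPolynomial.monomial e 1) := by
    intro e
    have : (1 : ZMod 2) ⊗ₜ[ℤ] Ideal.Quotient.mkₐ ℤ (simplexJoin n L).stanleyReisnerIdeal
        (MvPolynomial.monomial e 1) =
        ((Algebra.TensorProduct.includeRight (R := ℤ) (A := ZMod 2)).comp
          (Ideal.Quotient.mkₐ ℤ (simplexJoin n L).stanleyReisnerIdeal))
            (MvPolynomial.monomial e 1) := rfl
    rw [this, MvPolynomial.monomial_eq, map_mul, Finsupp.prod, Finsupp.prod, map_prod]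
    simp only [map_pow, map_one, one_mul]
    rfl
  apply le_antisymm
  · rw [gradingModTwo, Submodule.baseChange_eq_span, Submodule.span_le]
    rintro _ ⟨_, ⟨p, hp, rfl⟩, rfl⟩
    rw [p.as_sum]
    simp only [map_sum]
    refine sum_mem fun e he => ?_
    have hc : MvPolynomial.monomial e (p.coeff e) =
        p.coeff e • MvPolynomial.monomial e (1 : ℤ) := by
      rw [MvPolynomial.smul_monomial, smul_eq_mul, mul_one]
    rw [hc, map_smul, map_smul]
    have hmem := Submodule.subset_span (R := ZMod 2) (s := {a | ∃ e : Fin n ⊕ V →₀ ℕ,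
      Finsupp.weight (degree46 n V) e = d ∧ a = e.prod fun v k => gen n L v ^ k})
      ⟨e, hp (MvPolynomial.mem_support_iff.mp he), rfl⟩
    rw [hmon] at hmem
    exact zsmul_mem hmem _
  · rw [Submodule.span_le]
    rintro _ ⟨e, he, rfl⟩
    rw [hmon]
    exact Submodule.tmul_mem_baseChange_of_mem _
      ⟨_, MvPolynomial.isWeightedHomogeneous_monomial _ e 1 he, rfl⟩

variable (n L) in
/-- The generators present `A(n, L) ⊗ ℤ/2`. -/
theorem isModTwoPresentation : (simplexJoin n L).IsModTwoPresentation (degree46 n V)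
    (gradingModTwo n L) (gen n L) where
  prod_gen_eq_zero := prod_gen_eq_zero
  exists_lift _ _ _ g hg := ⟨lift g hg, lift_gen g hg⟩
  ringHom_ext _ _ _ _ h := ringHom_ext h
  grading_eq_span := gradingModTwo_eq_span

end Generators

end AlgA

/-! ### Faces of the join and elements of low degree -/

theorem mem_faces_simplexJoin {V : Type*} {n : ℕ} {L : AbstractSimplicialComplex V}
    {s : Finset (Fin n ⊕ V)} : s ∈ (simplexJoin n L).faces ↔
    s.Nonempty ∧ (s.toRight = ∅ ∨ s.toRight ∈ L.faces) := by
  have htop : s.toLeft = ∅ ∨ s.toLeft ∈ (⊤ : AbstractSimplicialComplex (Fin n)).faces :=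
    s.toLeft.eq_empty_or_nonempty
  change (_ ∧ _ ∧ _) ↔ _
  simp [htop]

theorem prod_pow_eq_of_sum_eq_one {ι M : Type*} [Fintype ι] [CommMonoid M] (f : ι → ℕ)
    (hf : ∑ i, f i = 1) (g : ι → M) : ∃ i, ∏ j, g j ^ f j = g i := by
  classical
  obtain ⟨i, -, hi⟩ := Finset.exists_ne_zero_of_sum_ne_zero (hf.trans_ne one_ne_zero)
  have h := Finset.sum_erase_add Finset.univ f (Finset.mem_univ i)
  have h0 : ∑ j ∈ Finset.univ.erase i, f j = 0 := by omega
  have h1 : f i = 1 := by omega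
  refine ⟨i, ?_⟩
  rw [Finset.prod_eq_single i, h1, pow_one]
  · intro j _ hj
    rw [Finset.sum_eq_zero_iff.mp h0 j (Finset.mem_erase.mpr ⟨hj, Finset.mem_univ j⟩), pow_zero]
  · intro h
    exact absurd (Finset.mem_univ i) h

theorem prod_pow_eq_of_sum_eq_zero {ι M : Type*} [Fintype ι] [CommMonoid M] (f : ι → ℕ)
    (hf : ∑ i, f i = 0) (g : ι → M) : ∏ j, g j ^ f j = 1 :=
  Finset.prod_eq_one fun j hj => by rw [Finset.sum_eq_zero_iff.mp hf j hj, pow_zero]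

namespace Finsupp

variable {M : Type*} [CommMonoid M] {V : Type*} {n : ℕ} [Fintype V]

theorem prod_pow_sum_type (g : Fin n ⊕ V → M) (e : Fin n ⊕ V →₀ ℕ) :
    (e.prod fun v k => g v ^ k) = (∏ i, g (.inl i) ^ e (.inl i)) *
      ∏ v, g (.inr v) ^ e (.inr v) := by
  rw [Finsupp.prod_fintype _ _ (fun _ => pow_zero _), Fintype.prod_sum_type]

theorem weight_degree46 (e : Fin n ⊕ V →₀ ℕ) :
    Finsupp.weight (degree46 n V) e = 4 * ∑ i, e (.inl i) + 6 * ∑ v, e (.inr v) := by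
  rw [Finsupp.weight_apply, Finsupp.sum_fintype _ _ (fun _ => by simp),
    Fintype.sum_sum_type, Finset.mul_sum, Finset.mul_sum]
  simp [degree46, mul_comm]

end Finsupp

namespace SimpleGraph

open Geometry.AbstractSimplicialComplex (ofSimpleGraph)

variable {V : Type*} [DecidableEq V] (G : SimpleGraph V)

theorem singleton_mem_faces (v : V) : {v} ∈ (ofSimpleGraph G).faces := Or.inl ⟨v, rfl⟩

theorem pair_mem_faces {v w : V} (h : G.Adj v w) : {v, w} ∈ (ofSimpleGraph G).faces :=
  Or.inr ⟨s(v, w), h, Sym2.toFinset_mk_eq⟩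

theorem mem_faces_iff {s : Finset V} : s ∈ (ofSimpleGraph G).faces ↔
    (∃ v, s = {v}) ∨ ∃ v w, G.Adj v w ∧ s = {v, w} := by
  constructor
  · rintro (h | ⟨e, he, rfl⟩)
    · exact Or.inl h
    · induction e with
      | h v w => exact Or.inr ⟨v, w, he, Sym2.toFinset_mk_eq⟩
  · rintro (⟨v, rfl⟩ | ⟨v, w, h, rfl⟩)
    · exact singleton_mem_faces G v
    · exact pair_mem_faces G h

end SimpleGraph

namespace AbstractSimplicialComplex.IsModTwoPresentation

open Polynomial

universe w

section General

variable {W : Type*} {K : AbstractSimplicialComplex W} {φ : W → ℕ} {A : Type*} [CommRing A]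
  [Algebra (ZMod 2) A] {𝒜 : ℕ → Submodule (ZMod 2) A} {gen : W → A}

theorem gen_mem (hA : K.IsModTwoPresentation φ 𝒜 gen) (v : W) : gen v ∈ 𝒜 (φ v) := by
  rw [hA.grading_eq_span]
  exact Submodule.subset_span ⟨Finsupp.single v 1, by simp [Finsupp.weight_single], by simp⟩

end General

variable {V : Type*} {n : ℕ} {L : AbstractSimplicialComplex V} {A : Type*} [CommRing A]
  [Algebra (ZMod 2) A] {𝒜 : ℕ → Submodule (ZMod 2) A} {gen : Fin n ⊕ V → A}

/-- There is a homomorphism that takes arbitrary values on the generators of degree 4 and on the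
vertices of a face `σ`, and vanishes on the other vertices. -/
theorem exists_liftFace {S : Type w} [CommRing S] [Algebra (ZMod 2) S]
    (hA : (simplexJoin n L).IsModTwoPresentation.{w} (degree46 n V) 𝒜 gen) (σ : Finset V)
    (hσ : σ ∈ L.faces) (c : Fin n → S) (d : V → S) (hd : ∀ v ∉ σ, d v = 0) :
    ∃ f : A →ₐ[ZMod 2] S, (∀ i, f (gen (.inl i)) = c i) ∧ ∀ v, f (gen (.inr v)) = d v := by
  obtain ⟨f, hf⟩ := hA.exists_lift S (Sum.elim c d) (by
    intro s hs hsK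
    rw [mem_faces_simplexJoin] at hsK
    push Not at hsK
    obtain ⟨h1, h2⟩ := hsK hs
    have hns : ¬ s.toRight ⊆ σ := fun h =>
      h2 ((L.isRelLowerSet_faces hσ).2 h h1)
    obtain ⟨v, hv, hvσ⟩ := Finset.not_subset.mp hns
    exact Finset.prod_eq_zero (Finset.mem_toRight.mp hv) (hd v hvσ))
  exact ⟨f, fun i => hf (.inl i), fun v => hf (.inr v)⟩

theorem nontrivial
    (hA : (simplexJoin n L).IsModTwoPresentation.{0} (degree46 n V) 𝒜 gen) : Nontrivial A := by
  obtain ⟨f, -⟩ := hA.exists_lift (ZMod 2) (fun _ => 0)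
    fun s hs _ => Finset.prod_eq_zero hs.choose_spec rfl
  exact f.toRingHom.domain_nontrivial

/-- Elements of degree 6 are linear forms in the generators of degree 6. -/
theorem exists_sum_of_mem_six [Fintype V]
    (hA : (simplexJoin n L).IsModTwoPresentation (degree46 n V) 𝒜 gen) {a : A}
    (ha : a ∈ 𝒜 6) :
    ∃ c : V → ZMod 2, ∑ v, c v • gen (.inr v) = a := by
  rw [← Submodule.mem_span_range_iff_exists_fun]
  rw [hA.grading_eq_span] at ha
  refine Submodule.span_mono ?_ ha
  rintro _ ⟨e, he, rfl⟩
  rw [Finsupp.weight_degree46] at he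
  obtain ⟨v, hv⟩ := prod_pow_eq_of_sum_eq_one (fun v => e (.inr v)) (by omega)
    (fun v => gen (.inr v))
  refine ⟨v, ?_⟩
  rw [Finsupp.prod_pow_sum_type, prod_pow_eq_of_sum_eq_zero _ (by omega), one_mul]
  exact hv.symm

/-- Elements of degree 10 are bilinear in the generators of degrees 4 and 6. -/
theorem exists_sum_of_mem_ten [Fintype V]
    (hA : (simplexJoin n L).IsModTwoPresentation (degree46 n V) 𝒜 gen) {a : A}
    (ha : a ∈ 𝒜 10) :
    ∃ c : Fin n × V → ZMod 2, ∑ p, c p • (gen (.inl p.1) * gen (.inr p.2)) = a := by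
  rw [← Submodule.mem_span_range_iff_exists_fun]
  rw [hA.grading_eq_span] at ha
  refine Submodule.span_mono ?_ ha
  rintro _ ⟨e, he, rfl⟩
  rw [Finsupp.weight_degree46] at he
  obtain ⟨i, hi⟩ := prod_pow_eq_of_sum_eq_one (fun i => e (.inl i)) (by omega)
    (fun i => gen (.inl i))
  obtain ⟨v, hv⟩ := prod_pow_eq_of_sum_eq_one (fun v => e (.inr v)) (by omega)
    (fun v => gen (.inr v))
  refine ⟨(i, v), ?_⟩
  rw [Finsupp.prod_pow_sum_type]
  exact (congrArg₂ (· * ·) hi hv).symm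

theorem eq_zero_of_mem_odd [Finite V]
    (hA : (simplexJoin n L).IsModTwoPresentation (degree46 n V) 𝒜 gen) {a : A} {d : ℕ} (hd : Odd d)

    (ha : a ∈ 𝒜 d) : a = 0 := by
  have := Fintype.ofFinite V
  rw [hA.grading_eq_span] at ha
  refine Submodule.span_induction ?_ rfl ?_ ?_ ha
  · rintro _ ⟨e, he, rfl⟩
    rw [Finsupp.weight_degree46] at he
    obtain ⟨k, hk⟩ := hd
    omega
  · rintro _ _ _ _ rfl rfl; exact add_zero 0
  · rintro c _ _ rfl; exact smul_zero c

/-- Elements of degree 8 are quadratic forms in the generators of degree 4, so their images are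
multiples of `X²` if the generators of degree 4 map to multiples of `X`. -/
theorem exists_image_of_mem_eight [Finite V]
    (hA : (simplexJoin n L).IsModTwoPresentation (degree46 n V) 𝒜 gen) {a : A}
    (ha : a ∈ 𝒜 8)
    (f : A →ₐ[ZMod 2] (ZMod 2)[X]) (c : Fin n → ZMod 2)
    (hf : ∀ i, f (gen (.inl i)) = C (c i) * X) : ∃ k : ZMod 2, f a = C k * X ^ 2 := by
  have := Fintype.ofFinite V
  rw [hA.grading_eq_span] at ha
  refine Submodule.span_induction ?_ ⟨0, by simp⟩ ?_ ?_ ha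
  · rintro _ ⟨e, he, rfl⟩
    rw [Finsupp.weight_degree46] at he
    refine ⟨∏ i, c i ^ e (.inl i), ?_⟩
    rw [Finsupp.prod_pow_sum_type, prod_pow_eq_of_sum_eq_zero (fun v => e (.inr v)) (by omega),
      mul_one, map_prod f]
    simp only [map_pow, hf, mul_pow, Finset.prod_mul_distrib, Finset.prod_pow_eq_pow_sum, map_prod]
    congr 2
    omega
  · rintro _ _ _ _ ⟨k, hk⟩ ⟨l, hl⟩
    exact ⟨k + l, by rw [map_add, hk, hl, C_add, add_mul]⟩
  · rintro b _ _ ⟨k, hk⟩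
    exact ⟨b * k, by rw [map_smul, hk, smul_eq_C_mul, C_mul, mul_assoc]⟩

section Graph

open Geometry.AbstractSimplicialComplex (ofSimpleGraph)

variable [DecidableEq V] {G : SimpleGraph V}

theorem gen_mul_gen_of_not_adj
    (hA : (simplexJoin n (ofSimpleGraph G)).IsModTwoPresentation (degree46 n V) 𝒜 gen)
    {v w : V} (hne : v ≠ w) (h : ¬ G.Adj v w) :
    gen (.inr v) * gen (.inr w) = 0 := by
  have hne' : (Sum.inr v : Fin n ⊕ V) ≠ .inr w := fun h => hne (Sum.inr_injective h)
  rw [← Finset.prod_pair (f := gen) hne']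
  refine hA.prod_gen_eq_zero _ (Finset.insert_nonempty _ _) fun hmem => ?_
  rw [mem_faces_simplexJoin] at hmem
  have hR : ({.inr v, .inr w} : Finset (Fin n ⊕ V)).toRight = {v, w} := by ext; simp
  rw [hR, G.mem_faces_iff] at hmem
  rcases hmem.2 with h0 | ⟨a, h0⟩ | ⟨a, b, hab, h0⟩
  · simp at h0
  · have := congrArg Finset.card h0
    simp [hne] at this
  · have hv : v ∈ ({a, b} : Finset V) := h0 ▸ Finset.mem_insert_self v {w}
    have hw : w ∈ ({a, b} : Finset V) := h0 ▸ Finset.mem_insert_of_mem (Finset.mem_singleton_self w)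
    rw [Finset.mem_insert, Finset.mem_singleton] at hv hw
    rcases hv with rfl | rfl <;> rcases hw with rfl | rfl
    · exact hne rfl
    · exact h hab
    · exact h hab.symm
    · exact hne rfl

/-- A graph has no two-dimensional faces. -/
theorem gen_mul_gen_mul_gen
    (hA : (simplexJoin n (ofSimpleGraph G)).IsModTwoPresentation (degree46 n V) 𝒜 gen)
    {v w u : V} (hvw : v ≠ w) (hvu : v ≠ u) (hwu : w ≠ u) :
    gen (.inr v) *
      (gen (.inr w) * gen (.inr u)) = 0 := by
  have h := hA.prod_gen_eq_zero {.inr v, .inr w, .inr u}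
    (Finset.insert_nonempty _ _) (fun hmem => ?_)
  · rwa [Finset.prod_insert (by simp [hvw, hvu]), Finset.prod_pair (by simp [hwu])] at h
  rw [mem_faces_simplexJoin] at hmem
  have hR : ({.inr v, .inr w, .inr u} : Finset (Fin n ⊕ V)).toRight = {v, w, u} := by ext; simp
  have hc : ({v, w, u} : Finset V).card = 3 := Finset.card_eq_three.mpr
    ⟨v, w, u, hvw, hvu, hwu, rfl⟩
  rw [hR, G.mem_faces_iff] at hmem
  rcases hmem.2 with h0 | ⟨a, h0⟩ | ⟨a, b, -, h0⟩
  · simp [h0] at hc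
  · simp [h0] at hc
  · have := Finset.card_le_two (a := a) (b := b)
    rw [← h0, hc] at this
    omega

end Graph

end AbstractSimplicialComplex.IsModTwoPresentation

/-! ### Coefficients of an unstable action -/

namespace UnstableSteenrodAction

variable {A : Type*} [CommRing A] [Algebra (ZMod 2) A] {𝒜 : ℕ → Submodule (ZMod 2) A}
  [GradedAlgebra 𝒜] (Φ : UnstableSteenrodAction 𝒜)

/-- The Steenrod square `Sqᵏ a`. -/
noncomputable def sq (k : ℕ) : Module.End (ZMod 2) A := Φ.act (SteenrodAlgebra.Sq k)

theorem sq_zero (a : A) : Φ.sq 0 a = a := by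
  have : SteenrodAlgebra.Sq 0 = 1 := by
    rw [SteenrodAlgebra.Sq, RingQuot.mkAlgHom_rel _ SteenrodRel.sq_zero, map_one]
  rw [sq, this, map_one, Module.End.one_apply]

/-- The Adem relation `Sq² Sq⁴ = Sq⁶ + Sq⁵ Sq¹`. -/
theorem sq_two_sq_four (a : A) : Φ.sq 2 (Φ.sq 4 a) = Φ.sq 6 a + Φ.sq 5 (Φ.sq 1 a) := by
  have h := RingQuot.mkAlgHom_rel (ZMod 2) (SteenrodRel.adem 2 4 (by norm_num) (by norm_num))
  rw [map_mul, map_sum, Finset.sum_range_succ, Finset.sum_range_one] at h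
  simp only [map_smul, map_mul] at h
  have h' := congrArg (fun x => Φ.act x a) h
  simp only [map_mul, map_add, map_smul, Module.End.mul_apply, LinearMap.add_apply,
    LinearMap.smul_apply] at h'
  have c0 : (((4 - 0 - 1).choose (2 - 2 * 0) : ℕ) : ZMod 2) = 1 := by decide
  have c1 : (((4 - 1 - 1).choose (2 - 2 * 1) : ℕ) : ZMod 2) = 1 := by decide
  rw [c0, c1, one_smul, one_smul] at h'
  refine h'.trans ?_
  congr 2
  exact Φ.sq_zero a

theorem sq_two_mul {a b : A} (ha : Φ.sq 1 a = 0) :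
    Φ.sq 2 (a * b) = a * Φ.sq 2 b + Φ.sq 2 a * b := by
  have h := Φ.cartan 2 a b
  simp only [Finset.sum_range_succ, Finset.sum_range_zero, zero_add] at h
  change Φ.sq 2 (a * b) = Φ.sq 0 a * Φ.sq 2 b + Φ.sq 1 a * Φ.sq 1 b + Φ.sq 2 a * Φ.sq 0 b at h
  rw [h, ha, zero_mul, add_zero, sq_zero, sq_zero]

theorem sq_four_mul {a b : A} (h1 : Φ.sq 1 a = 0) (h3 : Φ.sq 3 a = 0) :
    Φ.sq 4 (a * b) = a * Φ.sq 4 b + Φ.sq 2 a * Φ.sq 2 b + Φ.sq 4 a * b := by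
  have h := Φ.cartan 4 a b
  simp only [Finset.sum_range_succ, Finset.sum_range_zero, zero_add] at h
  change Φ.sq 4 (a * b) = Φ.sq 0 a * Φ.sq 4 b + Φ.sq 1 a * Φ.sq 3 b + Φ.sq 2 a * Φ.sq 2 b +
    Φ.sq 3 a * Φ.sq 1 b + Φ.sq 4 a * Φ.sq 0 b at h
  rw [h, h1, h3, zero_mul, zero_mul, add_zero, add_zero, sq_zero, sq_zero]

end UnstableSteenrodAction

namespace AbstractSimplicialComplex.IsModTwoPresentation

open Polynomial

section

variable {V : Type*} [Fintype V] {n : ℕ} {L : AbstractSimplicialComplex V} {A : Type*}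
  [CommRing A] [Algebra (ZMod 2) A] {𝒜 : ℕ → Submodule (ZMod 2) A} [GradedAlgebra 𝒜]
  {gen : Fin n ⊕ V → A} (Φ : UnstableSteenrodAction 𝒜)

theorem sq_odd_eq_zero (hA : (simplexJoin n L).IsModTwoPresentation (degree46 n V) 𝒜 gen) {k : ℕ}
    (hk : Odd k) (w : Fin n ⊕ V) : Φ.sq k (gen w) = 0 := by
  refine hA.eq_zero_of_mem_odd ?_ (Φ.degree k _ _ (hA.gen_mem w))
  refine Even.add_odd ?_ hk
  cases w <;> simp only [degree46, Sum.elim_inl, Sum.elim_inr] <;> decide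

/-- The relation `y² = Sq² Sq⁴ y`, in terms of the coefficients `F` of `Sq²` on the generators of
degree 4 and `q` of `Sq⁴` on those of degree 6, restricted to a face. -/
theorem sq_eq_sum (hA : (simplexJoin n L).IsModTwoPresentation.{0} (degree46 n V) 𝒜 gen)
    (F : Fin n → V → ZMod 2) (hF : ∀ i, ∑ v, F i v • gen (.inr v) = Φ.sq 2 (gen (.inl i)))
    (v : V) (q : Fin n × V → ZMod 2)
    (hq : ∑ p, q p • (gen (.inl p.1) * gen (.inr p.2)) = Φ.sq 4 (gen (.inr v)))
    (σ : Finset V) (hσ : σ ∈ L.faces) (d : V → (ZMod 2)[X]) (hd : ∀ v ∉ σ, d v = 0) :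
    d v ^ 2 = ∑ i, (∑ u, F i u • d u) * ∑ w, q (i, w) • d w := by
  obtain ⟨f, hf1, hf2⟩ := hA.exists_liftFace σ hσ (fun _ => (0 : (ZMod 2)[X])) d hd
  have h6 : Φ.sq 6 (gen (.inr v)) = gen (.inr v) ^ 2 :=
    Φ.unstable_eq 6 _ (hA.gen_mem (.inr v))
  have h := Φ.sq_two_sq_four (gen (.inr v))
  rw [h6, sq_odd_eq_zero Φ hA odd_one, map_zero, add_zero, ← hq, map_sum] at h
  have h' := congrArg f h
  rw [map_pow, hf2, map_sum] at h'
  rw [← h', Fintype.sum_prod_type]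
  refine Finset.sum_congr rfl fun i _ => ?_
  rw [Finset.mul_sum]
  refine Finset.sum_congr rfl fun w _ => ?_
  rw [map_smul, Φ.sq_two_mul (sq_odd_eq_zero Φ hA odd_one _), ← hF]
  simp only [map_smul, map_add, map_mul, map_sum, hf1, hf2, zero_mul, zero_add]
  rw [mul_smul_comm]

end

section Graph

open Geometry.AbstractSimplicialComplex (ofSimpleGraph)

variable {V : Type*} [Fintype V] [DecidableEq V] {n : ℕ} {G : SimpleGraph V} {A : Type*}
  [CommRing A] [Algebra (ZMod 2) A] {𝒜 : ℕ → Submodule (ZMod 2) A} [GradedAlgebra 𝒜]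
  {gen : Fin n ⊕ V → A} (Φ : UnstableSteenrodAction 𝒜)

/-- The coefficient of `x_i y_w` in `Sq⁴ y_v` vanishes if `w` has a neighbour `u ≠ v`: it is the
coefficient of `x_i y_w² y_u` in `Sq⁴ (y_v y_w y_u) = 0`. -/
theorem coeff_eq_zero_of_adj
    (hA : (simplexJoin n (ofSimpleGraph G)).IsModTwoPresentation.{0} (degree46 n V) 𝒜 gen)
    {v w u : V} (hvw : v ≠ w) (hvu : v ≠ u) (hwu : G.Adj w u) (q : Fin n × V → ZMod 2)
    (hq : ∑ p, q p • (gen (.inl p.1) * gen (.inr p.2)) = Φ.sq 4 (gen (.inr v))) (i : Fin n) :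
    q (i, w) = 0 := by
  -- The powers of `X` are chosen so that the four monomials of `Sq⁴ (y_v y_w y_u)` that survive
  -- have different degrees.
  obtain ⟨f, hf1, hf2⟩ := hA.exists_liftFace {w, u} (G.pair_mem_faces hwu)
    (fun j => C (Pi.single (M := fun _ => ZMod 2) i 1 j) * X)
    (fun a => Pi.single (M := fun _ => (ZMod 2)[X]) w 1 a +
      Pi.single (M := fun _ => (ZMod 2)[X]) u (X ^ 5) a) (by
      intro a ha
      rw [Finset.mem_insert, Finset.mem_singleton, not_or] at ha
      rw [Pi.single_eq_of_ne ha.1, Pi.single_eq_of_ne ha.2, add_zero])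
  have hfv : f (gen (.inr v)) = 0 := by
    rw [hf2, Pi.single_eq_of_ne hvw, Pi.single_eq_of_ne hvu, add_zero]
  have hfw : f (gen (.inr w)) = 1 := by
    rw [hf2, Pi.single_eq_same, Pi.single_eq_of_ne hwu.ne, add_zero]
  have hfu : f (gen (.inr u)) = X ^ 5 := by
    rw [hf2, Pi.single_eq_same, Pi.single_eq_of_ne hwu.ne', zero_add]
  have hf8 : ∀ a : V, ∃ k : ZMod 2, f (Φ.sq 2 (gen (.inr a))) = C k * X ^ 2 := fun a =>
    hA.exists_image_of_mem_eight (Φ.degree 2 6 _ (hA.gen_mem (.inr a))) f _ hf1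
  obtain ⟨kv, hkv⟩ := hf8 v
  obtain ⟨kw, hkw⟩ := hf8 w
  obtain ⟨ku, hku⟩ := hf8 u
  have hf10 : f (Φ.sq 4 (gen (.inr v))) = C (q (i, w)) * X + C (q (i, u)) * X ^ 6 := by
    rw [← hq, map_sum, Fintype.sum_prod_type, Finset.sum_eq_single i]
    · simp only [map_smul, map_mul, hf1, hf2, mul_add, smul_add, Finset.sum_add_distrib,
        Pi.single_eq_same, C_1, one_mul]
      rw [Finset.sum_eq_single w, Finset.sum_eq_single u, Pi.single_eq_same, Pi.single_eq_same,
        smul_eq_C_mul, smul_eq_C_mul]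
      · ring
      · intro b _ hb; rw [Pi.single_eq_of_ne hb, mul_zero, smul_zero]
      · simp
      · intro b _ hb; rw [Pi.single_eq_of_ne hb, mul_zero, smul_zero]
      · simp
    · intro j _ hj
      refine Finset.sum_eq_zero fun b _ => ?_
      rw [map_smul, map_mul, hf1, Pi.single_eq_of_ne hj, C_0, zero_mul, zero_mul, smul_zero]
    · simp
  have h := Φ.sq_four_mul (a := gen (.inr v)) (b := gen (.inr w) * gen (.inr u))
    (sq_odd_eq_zero Φ hA odd_one _) (sq_odd_eq_zero Φ hA (by decide) _)
  rw [hA.gen_mul_gen_mul_gen hvw hvu hwu.ne, map_zero,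
    Φ.sq_two_mul (sq_odd_eq_zero Φ hA odd_one _)] at h
  have h' := congrArg f h
  simp only [map_zero, map_add, map_mul, hfv, hfw, hfu, hkv, hkw, hku, hf10] at h'
  have h6 := congrArg (fun p : (ZMod 2)[X] => p.coeff 6) h'
  have e : (0 * f (Φ.sq 4 (gen (.inr w) * gen (.inr u))) +
      C kv * X ^ 2 * (1 * (C ku * X ^ 2) + C kw * X ^ 2 * X ^ 5) +
      (C (q (i, w)) * X + C (q (i, u)) * X ^ 6) * (1 * X ^ 5) : (ZMod 2)[X]) =
      C (kv * ku) * X ^ 4 + C (kv * kw) * X ^ 9 + C (q (i, w)) * X ^ 6 +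
        C (q (i, u)) * X ^ 11 := by
    rw [C_mul, C_mul]; ring
  rw [e] at h6
  generalize kv * ku = a at h6
  generalize kv * kw = b at h6
  simpa [coeff_X_pow] using h6.symm

end Graph

end AbstractSimplicialComplex.IsModTwoPresentation

/-! ### Span colourings in coordinates -/

namespace SimpleGraph

variable {V : Type*} (G : SimpleGraph V)

/-- A span colouring over `ℤ/2` in coordinates: the line of `v` is spanned by `ℓ v`, and its
hyperplane is the kernel of the linear form with coefficients `f v`. -/
def IsDualColouring {n : ℕ} (ℓ f : V → Fin n → ZMod 2) : Prop :=
  (∀ v, f v ⬝ᵥ ℓ v = 1) ∧ ∀ v w, G.Adj v w → f v ⬝ᵥ ℓ w = 0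

variable {G}

theorem IsDualColouring.nonempty_spanColouring {n : ℕ} {ℓ f : V → Fin n → ZMod 2}
    (h : G.IsDualColouring ℓ f) : Nonempty (G.SpanColouring (ZMod 2) n) := by
  have hℓ : ∀ v, ℓ v ≠ 0 := fun v h0 => by simpa [h0] using h.1 v
  refine ⟨⟨fun v => Submodule.span (ZMod 2) {ℓ v},
    fun v => LinearMap.ker (dotProductBilin (ZMod 2) (ZMod 2) (f v)),
    fun v => finrank_span_singleton (hℓ v), fun v => ?_, fun v hle => ?_, fun v w hvw => ⟨?_, ?_⟩⟩⟩
  · have hs : LinearMap.range (dotProductBilin (ZMod 2) (ZMod 2) (f v)) = ⊤ := by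
      rw [LinearMap.range_eq_top]
      intro c
      exact ⟨c • ℓ v, by simp [h.1 v]⟩
    have := LinearMap.finrank_range_add_finrank_ker (dotProductBilin (ZMod 2) (ZMod 2) (f v))
    rw [hs, finrank_top, Module.finrank_self, Module.finrank_fin_fun] at this
    omega
  · have := hle (Submodule.mem_span_singleton_self _)
    rw [LinearMap.mem_ker] at this
    exact one_ne_zero ((h.1 v).symm.trans this)
  · rw [Submodule.span_singleton_le_iff_mem, LinearMap.mem_ker]
    exact h.2 w v hvw.symm
  · rw [Submodule.span_singleton_le_iff_mem, LinearMap.mem_ker]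
    exact h.2 v w hvw

theorem SpanColouring.exists_isDualColouring {n : ℕ} (c : G.SpanColouring (ZMod 2) n) :
    ∃ ℓ f : V → Fin n → ZMod 2, G.IsDualColouring ℓ f := by
  have key : ∀ v, ∃ x : Fin n → ZMod 2, ∃ g : Fin n → ZMod 2, x ∈ c.line v ∧ g ⬝ᵥ x = 1 ∧
      ∀ y ∈ c.hyperplane v, g ⬝ᵥ y = 0 := by
    intro v
    obtain ⟨x, hx, hxW⟩ := SetLike.not_le_iff_exists.mp (c.not_line_le_hyperplane v)
    obtain ⟨g, hg, hgW⟩ := Submodule.exists_le_ker_of_notMem hxW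
    obtain ⟨g', rfl⟩ := (dotProductEquiv (ZMod 2) (Fin n)).surjective g
    refine ⟨x, g', hx, ?_, fun y hy => hgW hy⟩
    have h2 : ∀ a : ZMod 2, a ≠ 0 → a = 1 := by decide
    exact h2 _ hg
  choose ℓ f hℓ h1 h0 using key
  exact ⟨ℓ, f, h1, fun v w hvw => h0 v _ ((c.le_of_adj v w hvw).2 (hℓ w))⟩

theorem IsDualColouring.exists_of_le {m n : ℕ} (hmn : m ≤ n) {ℓ f : V → Fin m → ZMod 2}
    (h : G.IsDualColouring ℓ f) : ∃ ℓ f : V → Fin n → ZMod 2, G.IsDualColouring ℓ f := by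
  induction n, hmn using Nat.le_induction with
  | base => exact ⟨ℓ, f, h⟩
  | succ n _ ih =>
    obtain ⟨ℓ, f, h⟩ := ih
    refine ⟨fun v => Matrix.vecCons 0 (ℓ v), fun v => Matrix.vecCons 0 (f v), ?_, ?_⟩
    · intro v
      simpa using h.1 v
    · intro v w hvw
      simpa using h.2 v w hvw

theorem spanChromaticNumber_le_iff (n : ℕ) : G.spanChromaticNumber (ZMod 2) ≤ (n : ℕ∞) ↔
    ∃ ℓ f : V → Fin n → ZMod 2, G.IsDualColouring ℓ f := by
  constructor
  · intro h
    have hlt : G.spanChromaticNumber (ZMod 2) < ((n + 1 : ℕ) : ℕ∞) :=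
      h.trans_lt (by exact_mod_cast Nat.lt_succ_self n)
    simp only [spanChromaticNumber, iInf_lt_iff] at hlt
    obtain ⟨m, ⟨c⟩, hm⟩ := hlt
    obtain ⟨ℓ, f, hc⟩ := c.exists_isDualColouring
    exact hc.exists_of_le (Nat.lt_succ_iff.mp (by exact_mod_cast hm))
  · rintro ⟨ℓ, f, h⟩
    exact iInf₂_le n h.nonempty_spanColouring

/-- The vector `r v w` is the error term in the duality relation between `v` and `w`, and stands for
the coefficients of `y_w` in `Sq⁴ y_v`. It can be nonzero only if `w` is a leaf attached to `v`.
Such a leaf is coloured anew, so as to be dual to its neighbour. Of two leaves that are attached to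
each other only one is; the choice is made by a linear order. -/
theorem exists_isDualColouring {n : ℕ} (ℓ f : V → Fin n → ZMod 2) (r : V → V → Fin n → ZMod 2)
    (h1 : ∀ v, f v ⬝ᵥ ℓ v = 1)
    (h2 : ∀ v w, G.Adj v w → f w ⬝ᵥ ℓ v + f v ⬝ᵥ r v w = 0)
    (h3 : ∀ v w, G.Adj v w → f w ⬝ᵥ r v w = 0)
    (h4 : ∀ v w u, G.Adj v w → G.Adj w u → v ≠ u → r v w = 0) :
    ∃ ℓ f : V → Fin n → ZMod 2, G.IsDualColouring ℓ f := by
  classical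
  let _ : LinearOrder V := linearOrderOfSTO (WellOrderingRel (α := V))
  have htwo : ∀ a : ZMod 2, a + a = 0 := CharTwo.add_self_eq_zero
  -- The forms of adjacent vertices differ: otherwise `h2` and `h3` contradict `h1`.
  have hne : ∀ v w, G.Adj v w → f v ≠ f w := by
    intro v w hvw he
    have := h2 v w hvw
    rw [he, h3 v w hvw, ← he, h1, add_zero] at this
    exact one_ne_zero this
  have hdual : ∀ v w, G.Adj v w → ∃ x g : Fin n → ZMod 2, g ⬝ᵥ x = 1 ∧ f v ⬝ᵥ x = 0 ∧
      g ⬝ᵥ ℓ v = 0 := by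
    intro v w hvw
    -- The part of `f w` that vanishes on `ℓ v`.
    let g := f w + (f w ⬝ᵥ ℓ v) • f v
    have hg : g ⬝ᵥ ℓ v = 0 := by
      simp [g, add_dotProduct, smul_dotProduct, h1, htwo]
    have hg0 : g ≠ 0 := by
      intro h0
      have hw : f w ≠ 0 := fun h => by simpa [h] using h1 w
      have hc : ∀ a : ZMod 2, a = 0 ∨ a = 1 := by decide
      rcases hc (f w ⬝ᵥ ℓ v) with h | h
      · simp only [g, h, zero_smul, add_zero] at h0
        exact hw h0
      · simp only [g, h, one_smul] at h0
        exact hne v w hvw (funext fun i => (CharTwo.add_eq_zero.mp (congrFun h0 i)).symm)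
    obtain ⟨i, hi⟩ := Function.ne_iff.mp hg0
    have h2' : ∀ a : ZMod 2, a ≠ 0 → a = 1 := by decide
    let z : Fin n → ZMod 2 := Pi.single i 1
    have hz : g ⬝ᵥ z = 1 := by
      rw [dotProduct_single, mul_one]
      exact h2' _ hi
    refine ⟨z + (f v ⬝ᵥ z) • ℓ v, g, ?_, ?_, hg⟩
    · rw [dotProduct_add, dotProduct_smul, hg, hz, smul_zero, add_zero]
    · rw [dotProduct_add, dotProduct_smul, h1, smul_eq_mul, mul_one, htwo]
  -- The leaves `w` that are coloured anew, with their neighbours `v`.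
  let Q : V → V → Prop := fun w v =>
    G.Adj v w ∧ (∀ u, G.Adj w u → u = v) ∧ ((∀ u, G.Adj v u → u = w) → v < w)
  have hQ : ∀ w, ∃ x g : Fin n → ZMod 2, g ⬝ᵥ x = 1 ∧ ((¬ ∃ v, Q w v) → x = ℓ w ∧ g = f w) ∧
      ∀ v, Q w v → f v ⬝ᵥ x = 0 ∧ g ⬝ᵥ ℓ v = 0 := by
    intro w
    by_cases h : ∃ v, Q w v
    · obtain ⟨v, hv⟩ := h
      obtain ⟨x, g, hx, hfx, hg⟩ := hdual v w hv.1
      refine ⟨x, g, hx, fun h => absurd ⟨v, hv⟩ h, fun v' hv' => ?_⟩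
      rw [hv.2.1 v' hv'.1.symm]
      exact ⟨hfx, hg⟩
    · exact ⟨ℓ w, f w, h1 w, fun _ => ⟨rfl, rfl⟩, fun v hv => absurd ⟨v, hv⟩ h⟩
  choose ℓ' f' h1' hold hnew using hQ
  have hnot : ∀ v w, Q w v → ¬ ∃ u, Q v u := by
    rintro v w hwv ⟨u, hvu⟩
    have hu : w = u := hvu.2.1 w hwv.1
    subst hu
    exact lt_asymm (hwv.2.2 hvu.2.1) (hvu.2.2 hwv.2.1)
  refine ⟨ℓ', f', h1', fun v w hvw => ?_⟩
  by_cases hv : ∃ u, Q v u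
  · obtain ⟨u, hu⟩ := hv
    obtain rfl := hu.2.1 w hvw
    rw [(hold w (hnot w v hu)).1]
    exact (hnew v w hu).2
  · by_cases hw : ∃ u, Q w u
    · obtain ⟨u, hu⟩ := hw
      obtain rfl := hu.2.1 v hvw.symm
      rw [(hold v hv).2]
      exact (hnew w v hu).1
    · rw [(hold v hv).2, (hold w hw).1]
      -- Neither end is coloured anew, so `v` is not a leaf attached to `w`.
      have hr : r w v = 0 := by
        by_contra hr
        have hleaf : ∀ u, G.Adj v u → u = w := fun u hu => by
          by_contra hne'
          exact hr (h4 w v u hvw.symm hu fun h => hne' h.symm)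
        refine hv ⟨w, hvw.symm, hleaf, fun hleaf' => ?_⟩
        by_contra hlt
        exact hw ⟨v, hvw, hleaf', fun _ => lt_of_le_of_ne (not_lt.mp hlt) hvw.ne⟩
      have := h2 w v hvw.symm
      rwa [hr, dotProduct_zero, add_zero] at this

end SimpleGraph

/-! ### Equivalence of actions and colourings -/

namespace TotalSquare

/-- `Q(a) Q(b) x` for a generator `x` of degree 4 depends only on `a + b` and `a² b`. -/
theorem quaternionic_normalForm {B : Type*} [CommRing B] (h2 : (2 : B) = 0) (a b x F G : B) :
    (x + a * F + a ^ 2 * x ^ 2) + b * (F + a ^ 2 * G + a ^ 3 * F ^ 2) +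
      b ^ 2 * (x + a * F + a ^ 2 * x ^ 2) ^ 2 =
    x + (a + b) * F + (a + b) ^ 2 * x ^ 2 + a ^ 2 * b * G + a ^ 2 * b * (a + b) * F ^ 2 +
      (a ^ 2 * b) ^ 2 * x ^ 4 := by
  linear_combination (a * b ^ 2 * x * F + a ^ 2 * b ^ 2 * x ^ 3 + a ^ 3 * b ^ 2 * F * x ^ 2 -
    a * b * x ^ 2) * h2

/-- `Q(a) Q(b) y` for a generator `y` of degree 6 depends only on `a + b` and `a² b`. -/
theorem chern_normalForm {B : Type*} [CommRing B] (h2 : (2 : B) = 0) (a b y l M : B)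
    (hM : y * M = y ^ 2) :
    (y * (1 + a ^ 2 * l + a ^ 3 * y)) * (1 + b ^ 2 * (l + a * M + a ^ 2 * l ^ 2) +
      b ^ 3 * (y * (1 + a ^ 2 * l + a ^ 3 * y))) =
    y * (1 + l * (a + b) ^ 2 + y * ((a + b) ^ 3 + a ^ 2 * b) +
      (a ^ 2 * b) ^ 2 * (y ^ 2 + l ^ 3 + (a + b) * (l ^ 2 * y)) + (a ^ 2 * b) ^ 3 * y ^ 3) := by
  linear_combination (a * b ^ 2 * (1 + a ^ 2 * l + a ^ 3 * y)) * hM +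
    y * (a ^ 2 * b ^ 2 * l ^ 2 + l * y * (a ^ 2 * b ^ 3 + a ^ 3 * b ^ 2) + a ^ 3 * b ^ 3 * y ^ 2 +
      a ^ 5 * b ^ 3 * l * y ^ 2 - a * b * l - y * (2 * a ^ 2 * b + a * b ^ 2)) * h2

end TotalSquare

namespace AbstractSimplicialComplex.IsModTwoPresentation

open Polynomial TotalSquare

open Geometry.AbstractSimplicialComplex (ofSimpleGraph)

section Forward

variable {V : Type*} [Fintype V] [DecidableEq V] {n : ℕ} {G : SimpleGraph V} {A : Type*}
  [CommRing A] [Algebra (ZMod 2) A] {𝒜 : ℕ → Submodule (ZMod 2) A} [GradedAlgebra 𝒜]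
  {gen : Fin n ⊕ V → A}

theorem exists_isDualColouring_of_action
    (hA : (simplexJoin n (ofSimpleGraph G)).IsModTwoPresentation.{0} (degree46 n V) 𝒜 gen)
    (Φ : UnstableSteenrodAction 𝒜) : ∃ ℓ f : V → Fin n → ZMod 2, G.IsDualColouring ℓ f := by
  have hF : ∀ i, ∃ c : V → ZMod 2, ∑ v, c v • gen (.inr v) = Φ.sq 2 (gen (.inl i)) := fun i =>
    hA.exists_sum_of_mem_six (Φ.degree 2 4 _ (hA.gen_mem (.inl i)))
  have hq : ∀ v, ∃ c : Fin n × V → ZMod 2,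
      ∑ p, c p • (gen (.inl p.1) * gen (.inr p.2)) = Φ.sq 4 (gen (.inr v)) := fun v =>
    hA.exists_sum_of_mem_ten (Φ.degree 4 6 _ (hA.gen_mem (.inr v)))
  choose F hF using hF
  choose q hq using hq
  -- The relation `y_v² = Sq² Sq⁴ y_v`, restricted to the edge `vw` and dehomogenized.
  have hedge : ∀ v w, G.Adj v w → (1 : (ZMod 2)[X]) =
      ∑ i, (C (F i v) + C (F i w) * X) * (C (q v (i, v)) + C (q v (i, w)) * X) := by
    intro v w hvw
    have h := hA.sq_eq_sum Φ F hF v (q v) (hq v) {v, w} (G.pair_mem_faces hvw)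
      (fun a => Pi.single (M := fun _ => (ZMod 2)[X]) v 1 a +
        Pi.single (M := fun _ => (ZMod 2)[X]) w X a) (by
        intro a ha
        rw [Finset.mem_insert, Finset.mem_singleton, not_or] at ha
        rw [Pi.single_eq_of_ne ha.1, Pi.single_eq_of_ne ha.2, add_zero])
    have hsum : ∀ c : V → ZMod 2, ∑ a, c a • (Pi.single (M := fun _ => (ZMod 2)[X]) v 1 a +
        Pi.single (M := fun _ => (ZMod 2)[X]) w X a) = C (c v) + C (c w) * X := by
      intro c
      simp only [smul_add, Finset.sum_add_distrib]
      rw [Finset.sum_eq_single v, Finset.sum_eq_single w, Pi.single_eq_same, Pi.single_eq_same,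
        smul_eq_C_mul, smul_eq_C_mul, mul_one]
      · intro b _ hb; rw [Pi.single_eq_of_ne hb, smul_zero]
      · simp
      · intro b _ hb; rw [Pi.single_eq_of_ne hb, smul_zero]
      · simp
    simp only [hsum] at h
    rw [Pi.single_eq_same, Pi.single_eq_of_ne hvw.ne, add_zero, one_pow] at h
    exact h
  have hexp : ∀ a b c d : ZMod 2, (C a + C b * X) * (C c + C d * X) =
      C (a * c) + C (b * c + a * d) * X + C (b * d) * X ^ 2 := by
    intro a b c d
    simp only [C_mul, C_add]
    ring
  refine SimpleGraph.exists_isDualColouring (fun v i => q v (i, v)) (fun v i => F i v)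
    (fun v w i => q v (i, w)) ?_ ?_ ?_ ?_
  · intro v
    have h := hA.sq_eq_sum Φ F hF v (q v) (hq v) {v} (G.singleton_mem_faces v)
      (Pi.single (M := fun _ => (ZMod 2)[X]) v 1) (by
        intro a ha
        rw [Finset.mem_singleton] at ha
        exact Pi.single_eq_of_ne ha _)
    have hsum : ∀ c : V → ZMod 2,
        ∑ a, c a • Pi.single (M := fun _ => (ZMod 2)[X]) v 1 a = C (c v) := by
      intro c
      rw [Finset.sum_eq_single v, Pi.single_eq_same, smul_eq_C_mul, mul_one]
      · intro b _ hb; rw [Pi.single_eq_of_ne hb, smul_zero]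
      · simp
    simp only [hsum, Pi.single_eq_same, one_pow] at h
    have h' := congrArg (fun p : (ZMod 2)[X] => p.coeff 0) h
    simp only [finsetSum_coeff, ← C_mul, coeff_C_zero, coeff_one_zero] at h'
    exact h'.symm
  · intro v w hvw
    have h := congrArg (fun p : (ZMod 2)[X] => p.coeff 1) (hedge v w hvw)
    simp only [hexp, finsetSum_coeff, coeff_add, coeff_C_mul, coeff_X_one, coeff_X_pow,
      coeff_C_succ, coeff_one] at h
    norm_num at h
    rw [dotProduct, dotProduct, ← Finset.sum_add_distrib]
    exact h.symm
  · intro v w hvw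
    have h := congrArg (fun p : (ZMod 2)[X] => p.coeff 2) (hedge v w hvw)
    simp only [hexp, finsetSum_coeff, coeff_add, coeff_C_mul, coeff_X, coeff_X_pow,
      coeff_C_succ, coeff_one] at h
    norm_num at h
    exact h.symm
  · intro v w u hvw hwu hvu
    funext i
    exact hA.coeff_eq_zero_of_adj Φ hvw.ne hvu hwu (q v) (hq v) i

end Forward

section Backward

universe u

variable {V : Type*} [Fintype V] {n : ℕ} {A : Type u}
  [CommRing A] [Algebra (ZMod 2) A] {𝒜 : ℕ → Submodule (ZMod 2) A} {gen : Fin n ⊕ V → A}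
  {ℓ f : V → Fin n → ZMod 2}

variable (gen ℓ f) in
/-- The total squares of the generators: `x_i ↦ x_i + T² Sq² x_i + T⁴ x_i²`, where `Sq²` of a linear
form is given by the `f v`, and `y_v ↦ y_v (1 + T⁴ ℓ_v + T⁶ y_v)`. -/
noncomputable def squareGen : Fin n ⊕ V → A[X] :=
  Sum.elim
    (fun i => C (gen (.inl i)) + X ^ 2 * C (∑ v, f v i • gen (.inr v)) +
      X ^ 4 * C (gen (.inl i)) ^ 2)
    (fun v => C (gen (.inr v)) *
      (1 + X ^ 4 * C (∑ i, ℓ v i • gen (.inl i)) + X ^ 6 * C (gen (.inr v))))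

/-- The total squares of the generators extend to the algebra: the vertices of a non-face that
belong to the graph already form a non-face, and the total square of `y_v` is a multiple of `y_v`. -/
theorem exists_totalSquare [DecidableEq V] {G : SimpleGraph V}
    (hA : (simplexJoin n (ofSimpleGraph G)).IsModTwoPresentation.{u} (degree46 n V) 𝒜 gen) :
    ∃ P : A →ₐ[ZMod 2] A[X], ∀ w, P (gen w) = squareGen gen ℓ f w := by
  refine hA.exists_lift A[X] (squareGen gen ℓ f) fun s hs hsK => ?_
  rw [mem_faces_simplexJoin] at hsK
  push Not at hsK
  obtain ⟨h1, h2⟩ := hsK hs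
  let t : Finset (Fin n ⊕ V) := s.toRight.map Function.Embedding.inr
  have ht : t ⊆ s := by
    intro w hw
    obtain ⟨v, hv, rfl⟩ := Finset.mem_map.mp hw
    exact Finset.mem_toRight.mp hv
  have htR : t.toRight = s.toRight := by ext; simp [t]
  have h0 : ∏ w ∈ t, gen w = 0 := by
    refine hA.prod_gen_eq_zero t (h1.map) ?_
    rw [mem_faces_simplexJoin, htR]
    rintro ⟨-, h | h⟩
    · exact h1.ne_empty h
    · exact h2 h
  have h0' : ∏ w ∈ t, squareGen gen ℓ f w = 0 := by
    rw [Finset.prod_map] at h0 ⊢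
    change ∏ v ∈ s.toRight, (C (gen (.inr v)) * _) = 0
    rw [Finset.prod_mul_distrib, ← map_prod]
    change C (∏ v ∈ s.toRight, gen (.inr v)) * _ = 0
    rw [show ∏ v ∈ s.toRight, gen (.inr v) = 0 from h0, C_0, zero_mul]
  exact eq_zero_of_zero_dvd (h0' ▸ Finset.prod_dvd_prod_of_subset t s _ ht)

section Evaluation

variable {P : A →ₐ[ZMod 2] A[X]} {B : Type*} [CommRing B] [Algebra A B]

theorem evalAt_inl (hP : ∀ w, P (gen w) = squareGen gen ℓ f w) (α : B) (i : Fin n) :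
    evalAt (P : A →+* A[X]) α (gen (.inl i)) = algebraMap A B (gen (.inl i)) +
      α ^ 2 * algebraMap A B (∑ v, f v i • gen (.inr v)) +
        (α ^ 2) ^ 2 * algebraMap A B (gen (.inl i)) ^ 2 := by
  rw [evalAt_apply, AlgHom.coe_toRingHom, hP, squareGen, Sum.elim_inl]
  simp only [eval₂_add, eval₂_mul, eval₂_pow, eval₂_X, eval₂_C]
  ring

theorem evalAt_inr (hP : ∀ w, P (gen w) = squareGen gen ℓ f w) (α : B) (v : V) :
    evalAt (P : A →+* A[X]) α (gen (.inr v)) = algebraMap A B (gen (.inr v)) *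
      (1 + (α ^ 2) ^ 2 * algebraMap A B (∑ i, ℓ v i • gen (.inl i)) +
        (α ^ 2) ^ 3 * algebraMap A B (gen (.inr v))) := by
  rw [evalAt_apply, AlgHom.coe_toRingHom, hP, squareGen, Sum.elim_inr]
  simp only [eval₂_add, eval₂_mul, eval₂_pow, eval₂_X, eval₂_C, eval₂_one]
  ring

theorem sum_smul_sq [Module (ZMod 2) B] [CharP B 2] {ι : Type*} [Fintype ι]
    (c : ι → ZMod 2) (g : ι → B) :
    (∑ i, c i • g i) ^ 2 = ∑ i, c i • g i ^ 2 := by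
  rw [CharTwo.sum_sq]
  refine Finset.sum_congr rfl fun i _ => ?_
  obtain h | h : c i = 0 ∨ c i = 1 := by generalize c i = a; revert a; decide
  · rw [h, zero_smul, zero_smul, zero_pow two_ne_zero]
  · rw [h, one_smul, one_smul]

theorem mul_smul_zmod [Module (ZMod 2) B] (c : ZMod 2) (a b : B) : a * (c • b) = c • (a * b) :=
  ZMod.map_smul (AddMonoidHom.mulLeft a) c b

theorem evalAt_sum_inr [Module (ZMod 2) B] [CharP B 2]
    (hP : ∀ w, P (gen w) = squareGen gen ℓ f w) (α : B)
    (c : V → ZMod 2) :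
    evalAt (P : A →+* A[X]) α (∑ v, c v • gen (.inr v)) =
      algebraMap A B (∑ v, c v • gen (.inr v)) +
        (α ^ 2) ^ 2 * algebraMap A B (∑ v, c v • (gen (.inr v) * ∑ i, ℓ v i • gen (.inl i))) +
          (α ^ 2) ^ 3 * algebraMap A B (∑ v, c v • gen (.inr v)) ^ 2 := by
  simp only [map_sum, ZMod.map_smul, evalAt_inr hP, sum_smul_sq]
  rw [Finset.mul_sum, Finset.mul_sum, ← Finset.sum_add_distrib, ← Finset.sum_add_distrib]
  refine Finset.sum_congr rfl fun v _ => ?_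
  rw [mul_smul_zmod, mul_smul_zmod, ← smul_add, ← smul_add]
  simp only [map_mul, map_sum, ZMod.map_smul]
  congr 1
  ring

theorem evalAt_sum_inl [Module (ZMod 2) B] [CharP B 2]
    (hP : ∀ w, P (gen w) = squareGen gen ℓ f w) (α : B)
    (c : Fin n → ZMod 2) :
    evalAt (P : A →+* A[X]) α (∑ i, c i • gen (.inl i)) =
      algebraMap A B (∑ i, c i • gen (.inl i)) +
        α ^ 2 * algebraMap A B (∑ i, c i • ∑ v, f v i • gen (.inr v)) +
          (α ^ 2) ^ 2 * algebraMap A B (∑ i, c i • gen (.inl i)) ^ 2 := by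
  simp only [map_sum, ZMod.map_smul, evalAt_inl hP, sum_smul_sq]
  rw [Finset.mul_sum, Finset.mul_sum, ← Finset.sum_add_distrib, ← Finset.sum_add_distrib]
  refine Finset.sum_congr rfl fun v _ => ?_
  rw [mul_smul_zmod, mul_smul_zmod, ← smul_add, ← smul_add]

/-- Duality of the colouring: `y_v Sq² ℓ_v = y_v²`, as the other terms of `Sq² ℓ_v` are killed by
`y_v` or have coefficient zero. -/
theorem gen_mul_sum_sum [DecidableEq V] {G : SimpleGraph V}
    (hA : (simplexJoin n (ofSimpleGraph G)).IsModTwoPresentation.{u} (degree46 n V) 𝒜 gen)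
    (hG : G.IsDualColouring ℓ f) (v : V) :
    gen (.inr v) * ∑ i, ℓ v i • ∑ w, f w i • gen (.inr w) = gen (.inr v) ^ 2 := by
  have h : ∑ i, ℓ v i • ∑ w, f w i • gen (.inr w) = ∑ w, (f w ⬝ᵥ ℓ v) • gen (.inr w) := by
    simp only [Finset.smul_sum, smul_smul, dotProduct, Finset.sum_smul]
    rw [Finset.sum_comm]
    simp only [mul_comm]
  rw [h, Finset.mul_sum, Finset.sum_eq_single v]
  · rw [hG.1, one_smul, sq]
  · intro w _ hw
    by_cases hvw : G.Adj w v
    · rw [hG.2 w v hvw, zero_smul, mul_zero]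
    · rw [mul_smul_comm, hA.gen_mul_gen_of_not_adj hw.symm fun h => hvw h.symm, smul_zero]
  · simp

/-- Two composites `P_α P_β` agree if `α + β` and `α² β` do. -/
theorem evalAt₂_eq [DecidableEq V] {G : SimpleGraph V} [Module (ZMod 2) B] [CharP B 2]
    (hA : (simplexJoin n (ofSimpleGraph G)).IsModTwoPresentation.{u} (degree46 n V) 𝒜 gen)
    (hG : G.IsDualColouring ℓ f) (hP : ∀ w, P (gen w) = squareGen gen ℓ f w) {α β α' β' : B}
    (hadd : α + β = α' + β') (hmul : α ^ 2 * β = α' ^ 2 * β') (w : Fin n ⊕ V) :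
    evalAt₂ (P : A →+* A[X]) α β (gen w) = evalAt₂ (P : A →+* A[X]) α' β' (gen w) := by
  have h2 : (2 : B) = 0 := CharTwo.two_eq_zero
  have hadd' : α ^ 2 + β ^ 2 = α' ^ 2 + β' ^ 2 := by
    rw [← CharTwo.add_sq, hadd, CharTwo.add_sq]
  have hmul' : (α ^ 2) ^ 2 * β ^ 2 = (α' ^ 2) ^ 2 * β' ^ 2 := by
    rw [← mul_pow, hmul, mul_pow]
  rcases w with i | v
  · have h : ∀ α β : B, evalAt₂ (P : A →+* A[X]) α β (gen (.inl i)) =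
        algebraMap A B (gen (.inl i)) +
          (α ^ 2 + β ^ 2) * algebraMap A B (∑ v, f v i • gen (.inr v)) +
          (α ^ 2 + β ^ 2) ^ 2 * algebraMap A B (gen (.inl i)) ^ 2 +
          (α ^ 2) ^ 2 * β ^ 2 *
            algebraMap A B (∑ v, f v i • (gen (.inr v) * ∑ i, ℓ v i • gen (.inl i))) +
          (α ^ 2) ^ 2 * β ^ 2 * (α ^ 2 + β ^ 2) *
            algebraMap A B (∑ v, f v i • gen (.inr v)) ^ 2 +
          ((α ^ 2) ^ 2 * β ^ 2) ^ 2 * algebraMap A B (gen (.inl i)) ^ 4 := fun α β => by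
      rw [evalAt₂_apply, AlgHom.coe_toRingHom, hP, squareGen, Sum.elim_inl]
      simp only [eval₂_add, eval₂_mul, eval₂_pow, eval₂_X, eval₂_C]
      rw [evalAt_sum_inr hP, evalAt_inl hP, show β ^ 4 = (β ^ 2) ^ 2 by ring]
      rw [quaternionic_normalForm h2]
    rw [h, h, hadd', hmul']
  · have hM : algebraMap A B (gen (.inr v)) *
        algebraMap A B (∑ i, ℓ v i • ∑ w, f w i • gen (.inr w)) =
          algebraMap A B (gen (.inr v)) ^ 2 := by
      rw [← map_mul, hA.gen_mul_sum_sum hG, map_pow]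
    have h : ∀ α β : B, evalAt₂ (P : A →+* A[X]) α β (gen (.inr v)) =
        algebraMap A B (gen (.inr v)) *
          (1 + algebraMap A B (∑ i, ℓ v i • gen (.inl i)) * (α ^ 2 + β ^ 2) ^ 2 +
            algebraMap A B (gen (.inr v)) * ((α ^ 2 + β ^ 2) ^ 3 + (α ^ 2) ^ 2 * β ^ 2) +
            ((α ^ 2) ^ 2 * β ^ 2) ^ 2 * (algebraMap A B (gen (.inr v)) ^ 2 +
              algebraMap A B (∑ i, ℓ v i • gen (.inl i)) ^ 3 + (α ^ 2 + β ^ 2) *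
                (algebraMap A B (∑ i, ℓ v i • gen (.inl i)) ^ 2 *
                  algebraMap A B (gen (.inr v)))) +
            ((α ^ 2) ^ 2 * β ^ 2) ^ 3 * algebraMap A B (gen (.inr v)) ^ 3) := fun α β => by
      rw [evalAt₂_apply, AlgHom.coe_toRingHom, hP, squareGen, Sum.elim_inr]
      simp only [eval₂_add, eval₂_mul, eval₂_pow, eval₂_X, eval₂_C, eval₂_one]
      rw [evalAt_sum_inl hP, evalAt_inr hP, show β ^ 4 = (β ^ 2) ^ 2 by ring,
        show β ^ 6 = (β ^ 2) ^ 3 by ring, chern_normalForm h2 _ _ _ _ _ hM]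
    rw [h, h, hadd', hmul']

end Evaluation

theorem isUnstableAt_gen [DecidableEq V] {G : SimpleGraph V} [CharP A 2]
    [SetLike.GradedMonoid 𝒜] {P : A →ₐ[ZMod 2] A[X]}
    (hA : (simplexJoin n (ofSimpleGraph G)).IsModTwoPresentation.{u} (degree46 n V) 𝒜 gen)
    (hP : ∀ w, P (gen w) = squareGen gen ℓ f w) (w : Fin n ⊕ V) :
    IsUnstableAt 𝒜 P (degree46 n V w) (gen w) := by
  rcases w with i | v
  · have hx : gen (.inl i) ∈ 𝒜 4 := hA.gen_mem (.inl i)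
    have hy : ∑ v, f v i • gen (.inr v) ∈ 𝒜 6 :=
      sum_mem fun v _ => Submodule.smul_mem _ _ (hA.gen_mem (.inr v))
    have hx2 : gen (.inl i) ^ 2 ∈ 𝒜 8 := SetLike.pow_mem_graded 2 hx
    have h := hP (.inl i)
    rw [squareGen, Sum.elim_inl, ← C_pow, mul_comm (X ^ 2), mul_comm (X ^ 4)] at h
    refine ⟨fun k => ?_, ?_, ?_⟩
    · rw [h]
      simp only [coeff_add, coeff_C, coeff_C_mul, coeff_X_pow, degree46, Sum.elim_inl]
      refine add_mem (add_mem ?_ ?_) ?_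
      · split_ifs with hk
        · subst hk; exact hx
        · exact zero_mem _
      · split_ifs with hk
        · subst hk; rw [mul_one]; exact hy
        · rw [mul_zero]; exact zero_mem _
      · split_ifs with hk
        · subst hk; rw [mul_one]; exact hx2
        · rw [mul_zero]; exact zero_mem _
    · rw [h]
      change _ ≤ 4
      compute_degree
    · rw [h]
      change coeff _ 4 = _
      simp only [coeff_add, coeff_C, coeff_C_mul, coeff_X_pow]
      norm_num
  · have hx : ∑ i, ℓ v i • gen (.inl i) ∈ 𝒜 4 :=
      sum_mem fun i _ => Submodule.smul_mem _ _ (hA.gen_mem (.inl i))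
    have hy : gen (.inr v) ∈ 𝒜 6 := hA.gen_mem (.inr v)
    have hxy : gen (.inr v) * ∑ i, ℓ v i • gen (.inl i) ∈ 𝒜 10 := SetLike.mul_mem_graded hy hx
    have hy2 : gen (.inr v) ^ 2 ∈ 𝒜 12 := SetLike.pow_mem_graded 2 hy
    have h : P (gen (.inr v)) = C (gen (.inr v)) +
        C (gen (.inr v) * ∑ i, ℓ v i • gen (.inl i)) * X ^ 4 + C (gen (.inr v) ^ 2) * X ^ 6 := by
      rw [hP, squareGen, Sum.elim_inr, C_mul, C_pow]
      ring
    refine ⟨fun k => ?_, ?_, ?_⟩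
    · rw [h]
      simp only [coeff_add, coeff_C, coeff_C_mul, coeff_X_pow, degree46, Sum.elim_inr]
      refine add_mem (add_mem ?_ ?_) ?_
      · split_ifs with hk
        · subst hk; exact hy
        · exact zero_mem _
      · split_ifs with hk
        · subst hk; rw [mul_one]; exact hxy
        · rw [mul_zero]; exact zero_mem _
      · split_ifs with hk
        · subst hk; rw [mul_one]; exact hy2
        · rw [mul_zero]; exact zero_mem _
    · rw [h]
      change _ ≤ 6
      compute_degree
    · rw [h]
      change coeff _ 6 = _
      simp only [coeff_add, coeff_C, coeff_C_mul, coeff_X_pow]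
      norm_num

theorem nonempty_action [DecidableEq V] {G : SimpleGraph V} [GradedAlgebra 𝒜]
    [CharP A 2]
    (hA : (simplexJoin n (ofSimpleGraph G)).IsModTwoPresentation.{u} (degree46 n V) 𝒜 gen)
    (hG : G.IsDualColouring ℓ f) : Nonempty (UnstableSteenrodAction 𝒜) := by
  obtain ⟨P, hP⟩ := hA.exists_totalSquare (ℓ := ℓ) (f := f)
  refine ⟨unstableAction 𝒜 P (fun a => ?_) ?_ fun d a ha => ?_⟩
  · have h := hA.ringHom_ext A (constantCoeff.comp (P : A →+* A[X])) (RingHom.id A) (by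
      rintro (i | v)
      · simp [hP, squareGen]
      · simp [hP, squareGen])
    exact DFunLike.congr_fun h a
  · have := charP_of_injective_algebraMap (R := A) (A := (PowerSeries A)[X])
      (C_injective.comp PowerSeries.C_injective) 2
    have h2 : (2 : (PowerSeries A)[X]) = 0 := CharTwo.two_eq_zero
    refine hA.ringHom_ext _ _ _ (hA.evalAt₂_eq hG hP ?_ ?_)
    · simp only [map_add, C_pow, C_1]
      ring
    · simp only [map_add, C_pow, C_1]
      ring
  · rw [hA.grading_eq_span] at ha
    refine Submodule.span_induction ?_ IsUnstableAt.zero (fun _ _ _ _ => IsUnstableAt.add)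
      (fun c _ _ => IsUnstableAt.smul c) ha
    rintro _ ⟨e, rfl, rfl⟩
    rw [Finsupp.weight_apply]
    exact IsUnstableAt.prod _ fun w _ => (hA.isUnstableAt_gen hP w).pow (e w)

end Backward

end AbstractSimplicialComplex.IsModTwoPresentation

theorem mainTheorem1 {V : Type*} [Finite V] [DecidableEq V] (G : SimpleGraph V) (n : ℕ) :
    Nonempty (UnstableSteenrodAction
      (A := AlgA.ModTwo n (Geometry.AbstractSimplicialComplex.ofSimpleGraph G))
      (AlgA.gradingModTwo n (Geometry.AbstractSimplicialComplex.ofSimpleGraph G))) ↔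
      G.spanChromaticNumber (ZMod 2) ≤ (n : ℕ∞) := by
  have := Fintype.ofFinite V
  rw [SimpleGraph.spanChromaticNumber_le_iff]
  constructor
  · rintro ⟨Φ⟩
    exact (AlgA.isModTwoPresentation n _).exists_isDualColouring_of_action Φ
  · rintro ⟨ℓ, f, h⟩
    have := (AlgA.isModTwoPresentation n
      (Geometry.AbstractSimplicialComplex.ofSimpleGraph G)).nontrivial
    have := charP_of_injective_algebraMap (algebraMap (ZMod 2)
      (AlgA.ModTwo n (Geometry.AbstractSimplicialComplex.ofSimpleGraph G))).injective 2
    exact (AlgA.isModTwoPresentation n _).nonempty_action h
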